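/- Let $\Bbbk$ be a field of characteristic $0$, let $n\ge 0$, $R=\Bbbk[y_1,\dots,y_n]$, $I=\langle y_1+\cdots+y_n,\,y_1^2,\dots,y_n^2\rangle$ and $N=R/I$, graded by degree, with homogeneous components $N^{(k)}$ (the classes of the homogeneous polynomials of degree $k$). The symmetric group $S_n$ acts on $R$ by $\sigma P(y_1,\dots,y_n)=P(y_{\sigma(1)},\dots,y_{\sigma(n)})$, and hence on $N$ and on each $N^{(k)}$. For $0\le k\le\lfloor n/2\rfloor$ and a standard Young tableau $T$ of shape $(n-k,k)$ with entries $1,\dots,n$, let $$G_T=\prod_{j=1}^{k}\bigl(y_{T(1,j)}-y_{T(2,j)}\bigr),$$ where $T(i,j)$ is the entry of $T$ in row $i$ and column $j$. Then, for every $0\le k\le\lfloor n/2\rfloor$, the classes in $N$ of the polynomials $G_T$, for $T\in SYT_{(n-k,k)}$, form a $\Bbbk$-basis of $N^{(k)}$ (indexed by $SYT_{(n-k,k)}$). Moreover $N^{(k)}$ is an irreducible representation of $S_n$, and it is the one indexed by $(n-k,k)$: it is isomorphic to the Specht module $S^{(n-k,k)}$, the span in $R$ of the Specht polynomials (the products of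 the Vandermonde polynomials of the columns) of all bijective fillings of the diagram $(n-k,k)$ by $1,\dots,n$. Finally, $$\mathrm{Frob}_q(R/I)=\sum_{k\ge 0}\mathrm{Frob}\bigl(N^{(k)}\bigr)\,q^k=\sum_{k=0}^{\lfloor n/2\rfloor}s_{(n-k,k)}\,q^k ,$$ where $\mathrm{Frob}(V)=\frac1{n!}\sum_{\sigma\in S_n}\chi_V(\sigma)\,p_{\lambda(\sigma)}$ is the Frobenius characteristic of a finite-dimensional representation $V$ of $S_n$ with character $\chi_V$ (here $p_{\lambda(\sigma)}$ is the power-sum symmetric function of the cycle type $\lambda(\sigma)$ of $\sigma$), and $s_\lambda$ is the Schur function, the generating function of the semistandard Young tableaux of shape $\lambda$. -/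

import Mathlib

noncomputable section

namespace SpechtQuotient

open MvPolynomial

/-! ### Tableaux -/

/-- The Young diagram of the two-row partition `(n - k, k)`, for `k ≤ ⌊n / 2⌋`. -/
def twoRow (n k : ℕ) (hk : k ≤ n / 2) : YoungDiagram :=
  YoungDiagram.ofRowLens [n - k, k] (by
    rw [List.sortedGE_iff_pairwise]
    simp only [List.pairwise_cons, List.mem_singleton, forall_eq, List.not_mem_nil,
      false_implies, implies_true, List.Pairwise.nil, and_true]
    omega)

theorem mem_twoRow_zero {n k : ℕ} (hk : k ≤ n / 2) (j : Fin k) :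
    ((0, (j : ℕ)) : ℕ × ℕ) ∈ (twoRow n k hk).cells := by
  have := j.2
  rw [YoungDiagram.mem_cells, twoRow, YoungDiagram.mem_ofRowLens]
  refine ⟨by simp, ?_⟩
  simp only [List.getElem_cons_zero]
  omega

theorem mem_twoRow_one {n k : ℕ} (hk : k ≤ n / 2) (j : Fin k) :
    ((1, (j : ℕ)) : ℕ × ℕ) ∈ (twoRow n k hk).cells := by
  rw [YoungDiagram.mem_cells, twoRow, YoungDiagram.mem_ofRowLens]
  exact ⟨by simp, by simp⟩

/-- A tableau of shape `μ`: a bijective filling of the cells of `μ` by the `n` letters `Fin n`.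
A cell is a pair `(row, column)`, counted from `0`. -/
abbrev Tableau (μ : YoungDiagram) (n : ℕ) : Type := μ.cells ≃ Fin n

/-- A tableau is standard if its entries increase along the rows and down the columns. -/
def IsStandard {μ : YoungDiagram} {n : ℕ} (T : Tableau μ n) : Prop :=
  (∀ a b : μ.cells, a.1.1 = b.1.1 → a.1.2 < b.1.2 → T a < T b) ∧
  (∀ a b : μ.cells, a.1.2 = b.1.2 → a.1.1 < b.1.1 → T a < T b)

/-- Standard Young tableaux of shape `μ` with entries in `Fin n`. -/
abbrev SYT (μ : YoungDiagram) (n : ℕ) : Type := {T : Tableau μ n // IsStandard T}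

/-! ### Specht polynomials and Specht modules -/

/-- The polynomial `G_T = ∏_j (y_{T(1,j)} - y_{T(2,j)})` of a tableau of shape `(n - k, k)`. -/
def G (𝕜 : Type*) [Field 𝕜] {n k : ℕ} (hk : k ≤ n / 2) (T : Tableau (twoRow n k hk) n) :
    MvPolynomial (Fin n) 𝕜 :=
  ∏ j : Fin k, (X (T ⟨(0, j), mem_twoRow_zero hk j⟩) - X (T ⟨(1, j), mem_twoRow_one hk j⟩))

/-- The Specht polynomial of a tableau of arbitrary shape: the product over the columns of the
Vandermonde polynomials in the variables of that column. -/
def spechtPolynomial (𝕜 : Type*) [Field 𝕜] {μ : YoungDiagram} {n : ℕ} (T : Tableau μ n) :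
    MvPolynomial (Fin n) 𝕜 :=
  ∏ p : μ.cells × μ.cells with p.1.1.2 = p.2.1.2 ∧ p.1.1.1 < p.2.1.1, (X (T p.1) - X (T p.2))

/-- The action `(σ P)(y_1, …, y_n) = P(y_{σ 1}, …, y_{σ n})` of `S_n` on polynomials. -/
def polyRep (𝕜 : Type*) [Field 𝕜] (n : ℕ) :
    Representation 𝕜 (Equiv.Perm (Fin n)) (MvPolynomial (Fin n) 𝕜) where
  toFun σ := (rename σ).toLinearMap
  map_one' := LinearMap.ext fun p => by simp
  map_mul' σ τ := by
    refine LinearMap.ext fun p => ?_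
    simp [rename_rename, Equiv.Perm.coe_mul]

theorem polyRep_apply (𝕜 : Type*) [Field 𝕜] (n : ℕ) (σ : Equiv.Perm (Fin n))
    (p : MvPolynomial (Fin n) 𝕜) : polyRep 𝕜 n σ p = rename σ p := rfl

theorem rename_spechtPolynomial (𝕜 : Type*) [Field 𝕜] {μ : YoungDiagram} {n : ℕ}
    (σ : Equiv.Perm (Fin n)) (T : Tableau μ n) :
    rename σ (spechtPolynomial 𝕜 T) = spechtPolynomial 𝕜 (T.trans σ) := by
  simp [spechtPolynomial, map_prod]

/-- The Specht module `S^μ`, realised as the span of the Specht polynomials of all the tableaux of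
shape `μ`: the irreducible representation of `S_n` indexed by the partition `μ` of `n`. -/
def spechtModule (𝕜 : Type*) [Field 𝕜] (μ : YoungDiagram) (n : ℕ) :
    Subrepresentation (polyRep 𝕜 n) where
  toSubmodule := Submodule.span 𝕜 (Set.range fun T : Tableau μ n => spechtPolynomial 𝕜 T)
  apply_mem_toSubmodule σ := by
    intro v hv
    induction hv using Submodule.span_induction with
    | mem x hx =>
      obtain ⟨T, rfl⟩ := hx
      rw [polyRep_apply, rename_spechtPolynomial]
      exact Submodule.subset_span ⟨T.trans σ, rfl⟩
    | zero => rw [map_zero]; exact zero_mem _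
    | add x y _ _ hx hy => rw [map_add]; exact add_mem hx hy
    | smul a x _ hx => rw [map_smul]; exact Submodule.smul_mem _ a hx

/-! ### The quotient ring and its graded pieces -/

/-- The ideal `I = ⟨y_1 + ⋯ + y_n, y_1 ^ 2, …, y_n ^ 2⟩`. -/
def I (𝕜 : Type*) [Field 𝕜] (n : ℕ) : Ideal (MvPolynomial (Fin n) 𝕜) :=
  Ideal.span (insert (∑ i, X i) (Set.range fun i => X i ^ 2))

theorem I_le_comap (𝕜 : Type*) [Field 𝕜] (n : ℕ) (σ : Equiv.Perm (Fin n)) :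
    I 𝕜 n ≤ (I 𝕜 n).comap (rename (R := 𝕜) σ) := by
  refine Ideal.span_le.2 ?_
  rintro p (rfl | ⟨i, rfl⟩)
  · refine Ideal.subset_span (Or.inl ?_)
    simp only [map_sum, rename_X]
    exact Equiv.sum_comp σ fun i => (X i : MvPolynomial (Fin n) 𝕜)
  · refine Ideal.subset_span (Or.inr ⟨σ i, ?_⟩)
    simp

/-- The quotient ring `N = R / I`. -/
abbrev N (𝕜 : Type*) [Field 𝕜] (n : ℕ) : Type _ := MvPolynomial (Fin n) 𝕜 ⧸ I 𝕜 n

/-- The action of `S_n` on `N` induced by its action on polynomials. -/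
def quotRep (𝕜 : Type*) [Field 𝕜] (n : ℕ) : Representation 𝕜 (Equiv.Perm (Fin n)) (N 𝕜 n) where
  toFun σ := (Ideal.quotientMapₐ (I 𝕜 n) (rename σ) (I_le_comap 𝕜 n σ)).toLinearMap
  map_one' := by
    refine LinearMap.ext fun x => ?_
    obtain ⟨p, rfl⟩ := Ideal.Quotient.mk_surjective x
    simp [Ideal.quotient_map_mkₐ]
  map_mul' σ τ := by
    refine LinearMap.ext fun x => ?_
    obtain ⟨p, rfl⟩ := Ideal.Quotient.mk_surjective x
    simp [Ideal.quotient_map_mkₐ, rename_rename, Equiv.Perm.coe_mul]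

theorem quotRep_mk (𝕜 : Type*) [Field 𝕜] (n : ℕ) (σ : Equiv.Perm (Fin n))
    (p : MvPolynomial (Fin n) 𝕜) :
    quotRep 𝕜 n σ (Ideal.Quotient.mk (I 𝕜 n) p) = Ideal.Quotient.mk (I 𝕜 n) (rename σ p) := rfl

/-- The homogeneous component `N^(k)`: the classes of the homogeneous polynomials of degree `k`,
as an `S_n`-stable subspace of `N`. -/
def gradedPiece (𝕜 : Type*) [Field 𝕜] (n k : ℕ) : Subrepresentation (quotRep 𝕜 n) where
  toSubmodule := (homogeneousSubmodule (Fin n) 𝕜 k).map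
    (Ideal.Quotient.mkₐ 𝕜 (I 𝕜 n)).toLinearMap
  apply_mem_toSubmodule σ := by
    rintro _ ⟨p, hp, rfl⟩
    exact ⟨rename σ p, IsHomogeneous.rename_isHomogeneous hp, (quotRep_mk 𝕜 n σ p).symm⟩

/-! ### Symmetric functions and the Frobenius characteristic

Symmetric functions in the variables `x_0, x_1, x_2, …` are regarded as elements of the ring
`MvPowerSeries ℕ 𝕜` of formal power series. -/

/-- The power sum `p_m = ∑_i x_i ^ m`, for `m ≥ 1`. -/
def powerSum (𝕜 : Type*) [Field 𝕜] (m : ℕ) : MvPowerSeries ℕ 𝕜 :=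
  open Classical in fun d => if ∃ i, d = Finsupp.single i m then 1 else 0

/-- The power sum `p_{λ_1} p_{λ_2} ⋯` of the cycle type `λ` of `σ`, fixed points included. -/
def powerSumPerm (𝕜 : Type*) [Field 𝕜] {n : ℕ} (σ : Equiv.Perm (Fin n)) : MvPowerSeries ℕ 𝕜 :=
  (σ.partition.parts.map (powerSum 𝕜)).prod

/-- The content of a semistandard tableau: the exponent of its monomial `x^T`. -/
def content {μ : YoungDiagram} (T : SemistandardYoungTableau μ) : ℕ →₀ ℕ :=
  ∑ c ∈ μ.cells, Finsupp.single (T c.1 c.2) 1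

/-- The Schur function `s_μ = ∑_T x^T`, over the semistandard Young tableaux `T` of shape `μ`. -/
def schur (𝕜 : Type*) [Field 𝕜] (μ : YoungDiagram) : MvPowerSeries ℕ 𝕜 :=
  fun d => (Nat.card {T : SemistandardYoungTableau μ // content T = d} : 𝕜)

/-- The Frobenius characteristic `(1 / n!) ∑_σ χ(σ) p_{cycle type of σ}` of a representation of
`S_n`, where `χ` is its character. -/
def frob {𝕜 V : Type*} [Field 𝕜] [AddCommGroup V] [Module 𝕜 V] {n : ℕ}
    (ρ : Representation 𝕜 (Equiv.Perm (Fin n)) V) : MvPowerSeries ℕ 𝕜 :=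
  ((n.factorial : 𝕜)⁻¹) • ∑ σ : Equiv.Perm (Fin n), ρ.character σ • powerSumPerm 𝕜 σ

/-- The graded Frobenius characteristic `∑_{k ≥ 0} Frob(N^(k)) q^k` of `N = R / I`, a power series
in `q` whose coefficients are symmetric functions. -/
def frobQ (𝕜 : Type*) [Field 𝕜] (n : ℕ) : PowerSeries (MvPowerSeries ℕ 𝕜) :=
  PowerSeries.mk fun k => frob (gradedPiece 𝕜 n k).toRepresentation

end SpechtQuotient

end

noncomputable section

namespace SpechtQuotient

open MvPolynomial

/-! ### Square-zero variables -/

section SquareZero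

variable {ι A : Type*} [DecidableEq ι] [CommRing A]

/-! In `N` the variables square to zero and sum to zero, so `N^(k)` is spanned by the square-free
monomials `y_B` with `|B| = k`. Let `pairSpan` be the span of the products of `k` differences in
`2k` distinct variables; for `k ≤ n/2` it is the Specht module of `(n-k,k)`
(`toSubmodule_spechtModule`). Averaging over unused letters turns each monomial into such products
modulo `I`, so `pairSpan` maps onto `N^(k)`.

Injectivity comes from the dot product of square-free coefficients. Those of an element of `I` lie
in the image of `raise`, multiplication by `∑ y_i`; those of a product of differences are killed by
its transpose `lower`. Hence `pairSpan` is orthogonal to `I`. As each `y_B` is congruent mod `I` to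
an element of `pairSpan`, the form is nondegenerate on `pairSpan`, so `pairSpan ∩ I = 0`.

Irreducibility is James's submodule argument: a column antisymmetrizer maps square-free polynomials
of degree `k` to multiples of a single product of differences, and by nondegeneracy some
antisymmetrizer does not kill a given nonzero vector.

For the basis, the substitution `y_i ↦ t^(2^i)` gives the standard `G_T` distinct degrees, so they
are independent; straightening in `N` rewrites every `y_B` through the second rows of standard
tableaux, so the dimension is at most the number of those tableaux.

For the Frobenius characteristic, functions on `k`-subsets are equivariantly the sum of functions on
`(k-1)`-subsets and the Specht module, so the character is a difference of two fixed-subset counts.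
Burnside's lemma makes the coefficient of `x^d` equal to `#{b ≤ d, |b| = k} - #{b ≤ d, |b| = k-1}`.
A ballot count (`countBallot_eq`) gives the same number of semistandard tableaux of content `d`. -/

theorem sum_pow_eq_factorial_nsmul_sum {y : ι → A} (hy : ∀ i, y i * y i = 0) (S : Finset ι)
    (s : ℕ) :
    (∑ i ∈ S, y i) ^ s = s.factorial • ∑ F ∈ S.powersetCard s, ∏ i ∈ F, y i := by
  induction S using Finset.induction_on generalizing s with
  | empty =>
    cases s with
    | zero => simp
    | succ s => rw [Finset.powersetCard_eq_empty.2 (by simp)]; simp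
  | insert a S ha ih =>
    -- The binomial expansion stops after the term linear in `y a`, because `y a` squares to zero.
    have key : ∀ s : ℕ, (y a + ∑ i ∈ S, y i) ^ (s + 1) =
        (∑ i ∈ S, y i) ^ (s + 1) + (s + 1) • (y a * (∑ i ∈ S, y i) ^ s) := by
      intro s
      induction s with
      | zero => simp [add_comm]
      | succ s ihs =>
        rw [pow_succ, ihs]
        simp only [nsmul_eq_mul]
        push_cast
        linear_combination (s + 1 : A) * (∑ i ∈ S, y i) ^ s * hy a
    rw [Finset.sum_insert ha]
    cases s with
    | zero => simp
    | succ s =>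
      rw [key, ih, ih, Finset.powersetCard_succ_insert ha, Finset.sum_union, Finset.sum_image]
      · rw [smul_add, Nat.factorial_succ, mul_smul (s + 1) s.factorial (∑ F ∈ S.powersetCard s, _)]
        congr 2
        rw [mul_smul_comm, Finset.mul_sum]
        congr 1
        refine Finset.sum_congr rfl fun F hF => ?_
        rw [Finset.prod_insert fun h => ha ((Finset.mem_powersetCard.1 hF).1 h)]
      · intro F hF F' hF' h
        have h1 : a ∉ F := fun h => ha ((Finset.mem_powersetCard.1 hF).1 h)
        have h2 : a ∉ F' := fun h => ha ((Finset.mem_powersetCard.1 hF').1 h)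
        rw [← Finset.erase_insert h1, ← Finset.erase_insert h2, h]
      · rw [Finset.disjoint_left]
        intro F hF hF'
        obtain ⟨F', -, rfl⟩ := Finset.mem_image.1 hF'
        exact ha ((Finset.mem_powersetCard.1 hF).1 (Finset.mem_insert_self a F'))

theorem sum_pow_eq_zero_of_card_lt {y : ι → A} (hy : ∀ i, y i * y i = 0) {S : Finset ι} {s : ℕ}
    (h : S.card < s) : (∑ i ∈ S, y i) ^ s = 0 := by
  rw [sum_pow_eq_factorial_nsmul_sum hy, Finset.powersetCard_eq_empty.2 h]
  simp

theorem sum_pow_card {y : ι → A} (hy : ∀ i, y i * y i = 0) (S : Finset ι) :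
    (∑ i ∈ S, y i) ^ S.card = S.card.factorial • ∏ i ∈ S, y i := by
  rw [sum_pow_eq_factorial_nsmul_sum hy, Finset.powersetCard_self]
  simp

end SquareZero

/-! ### Products of differences over lists of pairs -/

section Pairs

variable {ι A : Type*} [CommRing A]

/-- The product of the differences `y a - y b` over a list of pairs `(a, b)`. -/
def pairProd (y : ι → A) (L : List (ι × ι)) : A := (L.map fun p => y p.1 - y p.2).prod

/-- The letters of a list of pairs. -/
def letters (L : List (ι × ι)) : List ι := L.flatMap fun p => [p.1, p.2]

@[simp] theorem pairProd_nil (y : ι → A) : pairProd y [] = 1 := rfl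

@[simp] theorem pairProd_cons (y : ι → A) (p : ι × ι) (L : List (ι × ι)) :
    pairProd y (p :: L) = (y p.1 - y p.2) * pairProd y L := by simp [pairProd]

@[simp] theorem letters_nil : letters ([] : List (ι × ι)) = [] := rfl

@[simp] theorem letters_cons (p : ι × ι) (L : List (ι × ι)) :
    letters (p :: L) = p.1 :: p.2 :: letters L := by simp [letters]

@[simp] theorem length_letters (L : List (ι × ι)) : (letters L).length = 2 * L.length := by
  induction L with
  | nil => rfl
  | cons p L ih => simp [ih]; ring

theorem map_pairProd {B : Type*} [CommRing B] (f : A →+* B) (y : ι → A) (L : List (ι × ι)) :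
    f (pairProd y L) = pairProd (f ∘ y) L := by
  induction L with
  | nil => simp
  | cons p L ih => simp [ih]

/-- Each pair contributes `(y a - y b) * (y a + y b) = y a ^ 2 - y b ^ 2 = 0`. -/
theorem pairProd_mul_sum_letters {y : ι → A} (hy : ∀ i, y i * y i = 0) (L : List (ι × ι)) :
    pairProd y L * ((letters L).map y).sum = 0 := by
  induction L with
  | nil => simp
  | cons p L ih =>
    simp only [pairProd_cons, letters_cons, List.map_cons, List.sum_cons]
    linear_combination (y p.1 - y p.2) * ih + pairProd y L * hy p.1 - pairProd y L * hy p.2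

end Pairs

/-! ### Trading single variables for differences -/

section Averaging

variable {ι A : Type*} [DecidableEq ι] [Fintype ι] [CommRing A]

/-- Averaging over the letters `b` that do not occur in `L` or `C`. -/
theorem sum_pairProd_cons_mul {y : ι → A} (hy : ∀ i, y i * y i = 0) (hs : ∑ i, y i = 0)
    {L : List (ι × ι)} (hL : (letters L).Nodup) {C : Finset ι}
    (hC : Disjoint (letters L).toFinset C) {c : ι} (hc : c ∈ C) :
    ∑ b ∈ ((letters L).toFinset ∪ C)ᶜ, pairProd y ((c, b) :: L) * ∏ i ∈ C.erase c, y i =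
      ((((letters L).toFinset ∪ C)ᶜ.card + 1 : ℕ) : A) * (pairProd y L * ∏ i ∈ C, y i) := by
  set O := ((letters L).toFinset ∪ C)ᶜ with hO
  -- Since all variables sum to zero, the sum over the unused letters is minus the sums over `L` and
  -- `C`. The part from `L` dies against `pairProd y L`; the part from `C` supplies one extra copy
  -- of the monomial, hence the `+ 1`.
  have h1 : ∑ i ∈ O, y i = - ((letters L).map y).sum - ∑ i ∈ C, y i := by
    have := Finset.sum_add_sum_compl ((letters L).toFinset ∪ C) y
    rw [hs, Finset.sum_union hC, List.sum_toFinset _ hL] at this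
    linear_combination this
  have h2 : (∑ i ∈ C, y i) * ∏ i ∈ C.erase c, y i = ∏ i ∈ C, y i := by
    rw [← Finset.add_sum_erase _ _ hc, add_mul, Finset.mul_prod_erase _ _ hc, Finset.sum_mul,
      Finset.sum_eq_zero, add_zero]
    intro i hi
    rw [← Finset.mul_prod_erase _ _ hi, ← mul_assoc, hy, zero_mul]
  have h3 := Finset.mul_prod_erase C y hc
  have h4 := pairProd_mul_sum_letters hy L
  calc _ = (∑ b ∈ O, (y c - y b)) * (pairProd y L * ∏ i ∈ C.erase c, y i) := by
        rw [Finset.sum_mul]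
        exact Finset.sum_congr rfl fun b _ => by simp [mul_assoc]
    _ = _ := by
        rw [Finset.sum_sub_distrib, h1, Finset.sum_const, nsmul_eq_mul]
        push_cast
        linear_combination (∏ i ∈ C.erase c, y i) * h4 + pairProd y L * h2 +
          (O.card : A) * pairProd y L * h3

/-- Induction on `|C|`: averaging replaces one variable `y c` by a difference `y c - y b` with `b`
unused, at the cost of the scalar `|O| + 1`, invertible in characteristic zero. When no letter is
unused the average is empty and the product is zero, so no bound on `k` is needed. -/
theorem pairProd_mul_prod_mem_span {𝕜 : Type*} [Field 𝕜] [CharZero 𝕜] [Algebra 𝕜 A] {y : ι → A}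
    (hy : ∀ i, y i * y i = 0) (hs : ∑ i, y i = 0) (k : ℕ) (C : Finset ι) :
    ∀ L : List (ι × ι), (letters L).Nodup → Disjoint (letters L).toFinset C →
      L.length + C.card = k →
      pairProd y L * ∏ i ∈ C, y i ∈ Submodule.span 𝕜
        {a | ∃ L : List (ι × ι), (letters L).Nodup ∧ L.length = k ∧ pairProd y L = a} := by
  induction h : C.card generalizing C with
  | zero =>
    intro L hL _ hk
    rw [Finset.card_eq_zero] at h
    subst h
    exact Submodule.subset_span ⟨L, hL, by simpa using hk, by simp⟩
  | succ m ih =>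
    intro L hL hLC hk
    obtain ⟨c, hc⟩ : C.Nonempty := Finset.card_pos.1 (by omega)
    have key := sum_pairProd_cons_mul hy hs hL hLC hc
    set O := ((letters L).toFinset ∪ C)ᶜ with hO
    have h0 : ((O.card + 1 : ℕ) : 𝕜) ≠ 0 := Nat.cast_ne_zero.2 (Nat.succ_ne_zero _)
    rw [← Submodule.smul_mem_iff _ h0, Algebra.smul_def, map_natCast, ← key]
    refine Submodule.sum_mem _ fun b hb => ?_
    rw [hO, Finset.mem_compl, Finset.mem_union, not_or, List.mem_toFinset] at hb
    have hcL : c ∉ letters L := fun h =>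
      Finset.disjoint_left.1 hLC (List.mem_toFinset.2 h) hc
    refine ih (C.erase c) (by rw [Finset.card_erase_of_mem hc]; omega) _ ?_ ?_ ?_
    · simp only [letters_cons, List.nodup_cons, List.mem_cons, not_or]
      exact ⟨⟨fun h => hb.2 (h ▸ hc), hcL⟩, hb.1, hL⟩
    · rw [Finset.disjoint_left] at hLC ⊢
      intro i hi hi'
      simp only [letters_cons, List.toFinset_cons, Finset.mem_insert] at hi
      rcases hi with rfl | rfl | hi
      · simp at hi'
      · exact hb.2 (Finset.mem_of_mem_erase hi')
      · exact hLC hi (Finset.mem_of_mem_erase hi')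
    · simp only [List.length_cons]
      omega

/-- The left side is `(∑_B y)^|B|`, which is `±(∑_{Bᶜ} y)^|B|`, a power exceeding the number of its
square-zero summands. -/
theorem factorial_nsmul_prod_eq_zero {y : ι → A} (hy : ∀ i, y i * y i = 0) (hs : ∑ i, y i = 0)
    {B : Finset ι} (hB : Bᶜ.card < B.card) : B.card.factorial • ∏ i ∈ B, y i = 0 := by
  have h : ∑ i ∈ B, y i = - ∑ i ∈ Bᶜ, y i := by
    have := Finset.sum_add_sum_compl B y
    rw [hs] at this
    linear_combination this
  rw [← sum_pow_card hy, h, neg_pow, sum_pow_eq_zero_of_card_lt hy hB, mul_zero]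

end Averaging

/-! ### Square-free monomials in the quotient -/

section Quotient

variable (𝕜 : Type*) [Field 𝕜] {n : ℕ}

/-- The class of the variable `y_i` in `N`. -/
def varN (i : Fin n) : N 𝕜 n := Ideal.Quotient.mk (I 𝕜 n) (X i)

theorem varN_mul_self (i : Fin n) : varN 𝕜 i * varN 𝕜 i = 0 := by
  rw [varN, ← map_mul, Ideal.Quotient.eq_zero_iff_mem, ← sq]
  exact Ideal.subset_span (Or.inr ⟨i, rfl⟩)

theorem sum_varN : ∑ i : Fin n, varN 𝕜 i = 0 := by
  simp only [varN]
  rw [← map_sum, Ideal.Quotient.eq_zero_iff_mem]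
  exact Ideal.subset_span (Or.inl rfl)

theorem mk_pairProd (L : List (Fin n × Fin n)) :
    Ideal.Quotient.mk (I 𝕜 n) (pairProd X L) = pairProd (varN 𝕜) L := map_pairProd _ _ _

theorem isHomogeneous_pairProd (L : List (Fin n × Fin n)) :
    (pairProd (X : Fin n → MvPolynomial (Fin n) 𝕜) L).IsHomogeneous L.length := by
  induction L with
  | nil => simpa using isHomogeneous_one (Fin n) 𝕜
  | cons p L ih =>
    rw [pairProd_cons, List.length_cons, add_comm]
    exact ((isHomogeneous_X 𝕜 p.1).sub (isHomogeneous_X 𝕜 p.2)).mul ih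

theorem isHomogeneous_prod_X (B : Finset (Fin n)) :
    (∏ i ∈ B, (X i : MvPolynomial (Fin n) 𝕜)).IsHomogeneous B.card := by
  have := IsHomogeneous.prod B (fun i => (X i : MvPolynomial (Fin n) 𝕜)) (fun _ => 1)
    fun i _ => isHomogeneous_X 𝕜 i
  simpa using this

theorem prod_varN_mem (B : Finset (Fin n)) :
    ∏ i ∈ B, varN 𝕜 i ∈ (gradedPiece 𝕜 n B.card).toSubmodule :=
  ⟨∏ i ∈ B, X i, isHomogeneous_prod_X 𝕜 B, by simp [varN]⟩

theorem pairProd_varN_mem (L : List (Fin n × Fin n)) :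
    pairProd (varN 𝕜) L ∈ (gradedPiece 𝕜 n L.length).toSubmodule :=
  ⟨pairProd X L, isHomogeneous_pairProd 𝕜 L, mk_pairProd 𝕜 L⟩

theorem gradedPiece_eq_span_prod_varN (k : ℕ) :
    (gradedPiece 𝕜 n k).toSubmodule =
      Submodule.span 𝕜 {a | ∃ B : Finset (Fin n), B.card = k ∧ ∏ i ∈ B, varN 𝕜 i = a} := by
  apply le_antisymm
  · rintro _ ⟨p, hp, rfl⟩
    rw [SetLike.mem_coe, mem_homogeneousSubmodule] at hp
    rw [p.as_sum, map_sum]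
    refine Submodule.sum_mem _ fun d hd => ?_
    have hdeg : d.degree = k := by
      by_contra h
      exact mem_support_iff.1 hd (hp.coeff_eq_zero h)
    have h1 : (Ideal.Quotient.mkₐ 𝕜 (I 𝕜 n)).toLinearMap (monomial d (coeff d p)) =
        coeff d p • ∏ i ∈ d.support, varN 𝕜 i ^ d i := by
      rw [← mul_one (coeff d p), ← smul_eq_mul, ← smul_monomial, map_smul, smul_eq_mul, mul_one]
      congr 1
      rw [monomial_eq, C_1, one_mul, Finsupp.prod]
      exact (map_prod (Ideal.Quotient.mk (I 𝕜 n)) _ _).trans (by simp only [map_pow]; rfl)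
    rw [h1]
    refine Submodule.smul_mem _ _ ?_
    by_cases hsq : ∃ i, 2 ≤ d i
    · obtain ⟨i, hi⟩ := hsq
      have : ∏ i ∈ d.support, varN 𝕜 i ^ d i = 0 := by
        refine Finset.prod_eq_zero (i := i) (Finsupp.mem_support_iff.2 (by omega)) ?_
        obtain ⟨m, hm⟩ := Nat.exists_eq_add_of_le hi
        rw [hm, pow_add, sq, varN_mul_self, zero_mul]
      rw [this]
      exact zero_mem _
    · push Not at hsq
      have h2 : ∀ i ∈ d.support, d i = 1 := fun i hi => by
        have := hsq i
        have := Finsupp.mem_support_iff.1 hi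
        omega
      refine Submodule.subset_span ⟨d.support, ?_, ?_⟩
      · rw [← hdeg, Finsupp.degree_apply, Finset.sum_congr rfl h2]
        simp
      · exact Finset.prod_congr rfl fun i hi => by rw [h2 i hi, pow_one]
  · rw [Submodule.span_le]
    rintro _ ⟨B, rfl, rfl⟩
    exact prod_varN_mem 𝕜 B

variable [CharZero 𝕜]

theorem gradedPiece_eq_span_pairProd (k : ℕ) :
    (gradedPiece 𝕜 n k).toSubmodule = Submodule.span 𝕜 {a | ∃ L : List (Fin n × Fin n),
      (letters L).Nodup ∧ L.length = k ∧ pairProd (varN 𝕜) L = a} := by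
  apply le_antisymm
  · rw [gradedPiece_eq_span_prod_varN, Submodule.span_le]
    rintro _ ⟨B, hB, rfl⟩
    have := pairProd_mul_prod_mem_span (𝕜 := 𝕜) (varN_mul_self 𝕜) (sum_varN 𝕜) k B []
      (by simp) (by simp) (by simpa using hB)
    simpa using this
  · rw [Submodule.span_le]
    rintro _ ⟨L, -, rfl, rfl⟩
    exact pairProd_varN_mem 𝕜 L

theorem prod_varN_eq_zero {B : Finset (Fin n)} (hB : n < 2 * B.card) :
    ∏ i ∈ B, varN 𝕜 i = 0 := by
  have h1 := factorial_nsmul_prod_eq_zero (varN_mul_self 𝕜) (sum_varN 𝕜) (B := B)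
    (by rw [Finset.card_compl, Fintype.card_fin]; omega)
  rw [← Nat.cast_smul_eq_nsmul 𝕜] at h1
  exact (smul_eq_zero.1 h1).resolve_left (Nat.cast_ne_zero.2 (Nat.factorial_ne_zero _))

theorem gradedPiece_eq_bot {k : ℕ} (hk : n / 2 < k) :
    (gradedPiece 𝕜 n k).toSubmodule = ⊥ := by
  rw [gradedPiece_eq_span_prod_varN, Submodule.span_eq_bot]
  rintro _ ⟨B, rfl, rfl⟩
  exact prod_varN_eq_zero 𝕜 (by omega)

end Quotient

/-! ### Square-free coefficients -/

section SquareFree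

variable (𝕜 : Type*) [Field 𝕜] {n : ℕ}

/-- The exponent of the square-free monomial `∏ i ∈ B, y_i`. -/
def indicatorExp (B : Finset (Fin n)) : Fin n →₀ ℕ := ∑ i ∈ B, Finsupp.single i 1

theorem indicatorExp_apply (B : Finset (Fin n)) (i : Fin n) :
    indicatorExp B i = if i ∈ B then 1 else 0 := by
  simp [indicatorExp, Finsupp.finsetSum_apply, Finsupp.single_apply]

theorem support_indicatorExp (B : Finset (Fin n)) : (indicatorExp B).support = B := by
  ext i
  simp [indicatorExp_apply]

theorem indicatorExp_injective :
    Function.Injective (indicatorExp : Finset (Fin n) → Fin n →₀ ℕ) := fun B C h => by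
  rw [← support_indicatorExp B, h, support_indicatorExp]

theorem indicatorExp_sub_single (B : Finset (Fin n)) (i : Fin n) :
    indicatorExp B - Finsupp.single i 1 = indicatorExp (B.erase i) := by
  ext j
  rw [Finsupp.tsub_apply, indicatorExp_apply, indicatorExp_apply, Finsupp.single_apply]
  by_cases h : i = j
  · subst h; simp; split_ifs <;> rfl
  · simp [h, Ne.symm h]

theorem indicatorExp_image (σ : Equiv.Perm (Fin n)) (B : Finset (Fin n)) :
    indicatorExp (B.image σ) = (indicatorExp B).mapDomain σ := by
  ext j
  obtain ⟨i, rfl⟩ := σ.surjective j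
  rw [Finsupp.mapDomain_apply σ.injective, indicatorExp_apply, indicatorExp_apply]
  simp

theorem prod_X_eq_monomial (B : Finset (Fin n)) :
    ∏ i ∈ B, (X i : MvPolynomial (Fin n) 𝕜) = monomial (indicatorExp B) 1 := by
  rw [indicatorExp, monomial_sum_one]
  rfl

/-- The coefficients of the square-free monomials of a polynomial. -/
def coefSF : MvPolynomial (Fin n) 𝕜 →ₗ[𝕜] (Finset (Fin n) → 𝕜) :=
  LinearMap.pi fun B => lcoeff 𝕜 (indicatorExp B)

theorem coefSF_apply (p : MvPolynomial (Fin n) 𝕜) (B : Finset (Fin n)) :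
    coefSF 𝕜 p B = coeff (indicatorExp B) p := rfl

theorem coefSF_prod_X (B : Finset (Fin n)) :
    coefSF 𝕜 (∏ i ∈ B, X i) = Pi.single B 1 := by
  ext C
  rw [prod_X_eq_monomial, coefSF_apply, coeff_monomial, Pi.single_apply]
  simp [indicatorExp_injective.eq_iff, eq_comm]

theorem coefSF_mul_X (p : MvPolynomial (Fin n) 𝕜) (i : Fin n) (B : Finset (Fin n)) :
    coefSF 𝕜 (p * X i) B = if i ∈ B then coefSF 𝕜 p (B.erase i) else 0 := by
  rw [coefSF_apply, coeff_mul_X', support_indicatorExp, indicatorExp_sub_single]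
  rfl

theorem coefSF_mul_X_sq (p : MvPolynomial (Fin n) 𝕜) (i : Fin n) :
    coefSF 𝕜 (p * X i ^ 2) = 0 := by
  ext B
  rw [sq, ← mul_assoc, coefSF_mul_X, coefSF_mul_X]
  simp

theorem coefSF_rename (σ : Equiv.Perm (Fin n)) (p : MvPolynomial (Fin n) 𝕜)
    (B : Finset (Fin n)) : coefSF 𝕜 (rename σ p) (B.image σ) = coefSF 𝕜 p B := by
  rw [coefSF_apply, indicatorExp_image, coeff_rename_mapDomain _ σ.injective, coefSF_apply]

/-- The polynomials without square-free terms form an ideal, the one generated by the squares of the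
variables. -/
theorem coefSF_mul_eq_zero {p : MvPolynomial (Fin n) 𝕜} (hp : coefSF 𝕜 p = 0)
    (q : MvPolynomial (Fin n) 𝕜) : coefSF 𝕜 (p * q) = 0 := by
  induction q using MvPolynomial.induction_on with
  | C a => rw [mul_comm, C_mul', map_smul, hp, smul_zero]
  | add q r hq hr => rw [mul_add, map_add, hq, hr, add_zero]
  | mul_X q i hq =>
    ext B
    rw [← mul_assoc, coefSF_mul_X, hq]
    simp

/-- Multiplication by `∑ i, y_i` on square-free coefficients. -/
def raise : (Finset (Fin n) → 𝕜) →ₗ[𝕜] (Finset (Fin n) → 𝕜) :=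
  LinearMap.pi fun B => ∑ i ∈ B, LinearMap.proj (B.erase i)

theorem raise_apply (f : Finset (Fin n) → 𝕜) (B : Finset (Fin n)) :
    raise 𝕜 f B = ∑ i ∈ B, f (B.erase i) := by
  simp [raise]

theorem coefSF_mul_sum_X (p : MvPolynomial (Fin n) 𝕜) :
    coefSF 𝕜 (p * ∑ i, X i) = raise 𝕜 (coefSF 𝕜 p) := by
  ext B
  rw [Finset.mul_sum, map_sum, Finset.sum_apply, raise_apply]
  simp [coefSF_mul_X]

/-- The generators `y_i ^ 2` are invisible to square-free coefficients, so only the multiple of `∑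
y_i` remains. -/
theorem exists_coefSF_eq_of_mem_I {p : MvPolynomial (Fin n) 𝕜} (hp : p ∈ I 𝕜 n) :
    ∃ q, coefSF 𝕜 (p - q * ∑ i, X i) = 0 := by
  obtain ⟨q, z, hz, rfl⟩ := Ideal.mem_span_insert.1 hp
  refine ⟨q, ?_⟩
  rw [add_sub_cancel_left]
  clear hp
  induction hz using Submodule.span_induction with
  | mem x hx =>
    obtain ⟨i, rfl⟩ := hx
    simpa using coefSF_mul_X_sq 𝕜 1 i
  | zero => exact map_zero _
  | add x y _ _ hx hy => rw [map_add, hx, hy, add_zero]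
  | smul a x _ hx =>
    rw [smul_eq_mul, mul_comm]
    exact coefSF_mul_eq_zero 𝕜 hx a

theorem exists_coefSF_eq_raise {p : MvPolynomial (Fin n) 𝕜} (hp : p ∈ I 𝕜 n) :
    ∃ f, coefSF 𝕜 p = raise 𝕜 f := by
  obtain ⟨q, hq⟩ := exists_coefSF_eq_of_mem_I 𝕜 hp
  refine ⟨coefSF 𝕜 q, ?_⟩
  rwa [map_sub, sub_eq_zero, coefSF_mul_sum_X] at hq

/-- The transpose of `raise`. -/
def lower (f : Finset (Fin n) → 𝕜) (F : Finset (Fin n)) : 𝕜 := ∑ i ∈ Fᶜ, f (insert i F)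

theorem dotProduct_raise (f g : Finset (Fin n) → 𝕜) :
    f ⬝ᵥ raise 𝕜 g = lower 𝕜 f ⬝ᵥ g := by
  simp only [dotProduct, raise_apply, lower, Finset.mul_sum, Finset.sum_mul]
  rw [Finset.sum_sigma', Finset.sum_sigma']
  -- Both sides are sums over pairs of a set and a letter: `i ∈ B` on the left, `i ∉ F` on the
  -- right, matched by `F = B \ {i}`.
  refine Finset.sum_bij' (fun x _ => ⟨x.1.erase x.2, x.2⟩) (fun x _ => ⟨insert x.2 x.1, x.2⟩)
    ?_ ?_ ?_ ?_ ?_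
  · simp
  · simp
  · rintro ⟨B, i⟩ h
    simp at h
    simp [Finset.insert_erase h]
  · rintro ⟨B, i⟩ h
    simp at h
    simp [Finset.erase_insert h]
  · rintro ⟨B, i⟩ h
    simp at h
    simp [Finset.insert_erase h]

theorem dotProduct_coefSF_rename (σ : Equiv.Perm (Fin n)) (p q : MvPolynomial (Fin n) 𝕜) :
    coefSF 𝕜 (rename σ p) ⬝ᵥ coefSF 𝕜 (rename σ q) = coefSF 𝕜 p ⬝ᵥ coefSF 𝕜 q := by
  simp only [dotProduct]
  refine (Fintype.sum_equiv σ.finsetCongr _ _ fun B => ?_).symm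
  rw [Equiv.finsetCongr_apply, Finset.map_eq_image]
  exact congrArg₂ _ (coefSF_rename 𝕜 σ p B).symm (coefSF_rename 𝕜 σ q B).symm

/-- The span of the square-free monomials of degree `k`. -/
def squareFree (n k : ℕ) : Submodule 𝕜 (MvPolynomial (Fin n) 𝕜) :=
  Submodule.span 𝕜 {p | ∃ B : Finset (Fin n), B.card = k ∧ ∏ i ∈ B, X i = p}

variable {𝕜}

theorem eq_sum_coefSF {k : ℕ} {p : MvPolynomial (Fin n) 𝕜} (hp : p ∈ squareFree 𝕜 n k) :
    p = ∑ B, coefSF 𝕜 p B • ∏ i ∈ B, X i := by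
  induction hp using Submodule.span_induction with
  | mem x hx =>
    obtain ⟨B, -, rfl⟩ := hx
    rw [coefSF_prod_X, Finset.sum_eq_single B]
    · simp
    · intro C _ h; simp [h]
    · simp
  | zero => simp
  | add x y _ _ hx hy =>
    conv_lhs => rw [hx, hy]
    simp [add_smul, Finset.sum_add_distrib]
  | smul a x _ hx =>
    conv_lhs => rw [hx]
    simp [mul_smul, Finset.smul_sum]

theorem coefSF_eq_zero_of_card_ne {k : ℕ} {p : MvPolynomial (Fin n) 𝕜}
    (hp : p.IsHomogeneous k) {B : Finset (Fin n)} (hB : B.card ≠ k) : coefSF 𝕜 p B = 0 := by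
  rw [coefSF_apply]
  refine hp.coeff_eq_zero ?_
  rwa [Finsupp.degree_apply, support_indicatorExp, Finset.sum_congr rfl (g := fun _ => 1)
    fun i hi => by rw [indicatorExp_apply, if_pos hi], Finset.sum_const, smul_eq_mul, mul_one]

theorem squareFree_le_homogeneousSubmodule (k : ℕ) :
    squareFree 𝕜 n k ≤ homogeneousSubmodule (Fin n) 𝕜 k := by
  rw [squareFree, Submodule.span_le]
  rintro _ ⟨B, rfl, rfl⟩
  exact isHomogeneous_prod_X 𝕜 B

theorem eq_zero_of_coefSF_eq_zero {k : ℕ} {p : MvPolynomial (Fin n) 𝕜}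
    (hp : p ∈ squareFree 𝕜 n k) (h : ∀ B : Finset (Fin n), B.card = k → coefSF 𝕜 p B = 0) :
    p = 0 := by
  rw [eq_sum_coefSF hp]
  refine Finset.sum_eq_zero fun B _ => ?_
  by_cases hB : B.card = k
  · rw [h B hB, zero_smul]
  · rw [coefSF_eq_zero_of_card_ne (squareFree_le_homogeneousSubmodule k hp) hB, zero_smul]

/-- Recording `B ⊆ letters` keeps the induction alive: a letter of a new pair is then absent from
every monomial already present, so multiplication stays square-free. -/
theorem pairProd_mem_span_prod_X {L : List (Fin n × Fin n)} (hL : (letters L).Nodup) :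
    pairProd (X : Fin n → MvPolynomial (Fin n) 𝕜) L ∈ Submodule.span 𝕜
      {p | ∃ B : Finset (Fin n), B.card = L.length ∧ B ⊆ (letters L).toFinset ∧
        ∏ i ∈ B, X i = p} := by
  induction L with
  | nil => exact Submodule.subset_span ⟨∅, by simp⟩
  | cons p L ih =>
    simp only [letters_cons, List.nodup_cons, List.mem_cons, not_or] at hL
    obtain ⟨⟨hab, ha⟩, hb, hL⟩ := hL
    rw [pairProd_cons]
    have key : ∀ c, c = p.1 ∨ c = p.2 →
        (X c : MvPolynomial (Fin n) 𝕜) * pairProd X L ∈ Submodule.span 𝕜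
      {q | ∃ B : Finset (Fin n), B.card = (p :: L).length ∧ B ⊆ (letters (p :: L)).toFinset ∧
        ∏ i ∈ B, X i = q} := by
      intro c hc
      have hcL : c ∉ letters L := by rcases hc with rfl | rfl <;> assumption
      have := Submodule.mem_map_of_mem (f := LinearMap.mulLeft 𝕜 (X c)) (ih hL)
      rw [Submodule.map_span] at this
      refine Submodule.span_mono ?_ this
      rintro _ ⟨_, ⟨B, hB, hBL, rfl⟩, rfl⟩
      have hcB : c ∉ B := fun h => hcL (List.mem_toFinset.1 (hBL h))
      refine ⟨insert c B, by simp [hcB, hB], ?_, ?_⟩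
      · intro i hi
        rcases Finset.mem_insert.1 hi with rfl | hi
        · rcases hc with rfl | rfl <;> simp
        · have := List.mem_toFinset.1 (hBL hi)
          simp [this]
      · simp [Finset.prod_insert hcB]
    rw [sub_mul]
    exact Submodule.sub_mem _ (key _ (Or.inl rfl)) (key _ (Or.inr rfl))

theorem pairProd_mem_squareFree {L : List (Fin n × Fin n)} (hL : (letters L).Nodup) :
    pairProd (X : Fin n → MvPolynomial (Fin n) 𝕜) L ∈ squareFree 𝕜 n L.length :=
  Submodule.span_mono (by rintro _ ⟨B, hB, -, rfl⟩; exact ⟨B, hB, rfl⟩)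
    (pairProd_mem_span_prod_X hL)

theorem coefSF_pairProd_eq_zero {L : List (Fin n × Fin n)} (hL : (letters L).Nodup)
    {c : Fin n} (hc : c ∉ letters L) {B : Finset (Fin n)} (hB : c ∈ B) :
    coefSF 𝕜 (pairProd X L) B = 0 := by
  refine Submodule.span_induction (p := fun p _ => coefSF 𝕜 p B = 0) ?_ ?_ ?_ ?_
    (pairProd_mem_span_prod_X hL)
  · rintro _ ⟨C, -, hC, rfl⟩
    rw [coefSF_prod_X, Pi.single_apply, if_neg]
    rintro rfl
    exact hc (List.mem_toFinset.1 (hC hB))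
  · simp
  · intro x y _ _ hx hy; simp [hx, hy]
  · intro a x _ hx; simp [hx]

/-- `lower` acts as `∑ ∂/∂y_i` on square-free polynomials; this is its Leibniz rule, corrected for
the terms of `p` already divisible by `X a`. -/
theorem lower_coefSF_mul_X (p : MvPolynomial (Fin n) 𝕜) (a : Fin n) (F : Finset (Fin n)) :
    lower 𝕜 (coefSF 𝕜 (p * X a)) F =
      (if a ∈ F then lower 𝕜 (coefSF 𝕜 p) (F.erase a) - coefSF 𝕜 p F else coefSF 𝕜 p F) := by
  simp only [lower, coefSF_mul_X]
  split_ifs with h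
  · rw [Finset.compl_erase, Finset.sum_insert (by simpa using h), Finset.insert_erase h,
      add_sub_cancel_left]
    refine Finset.sum_congr rfl fun i hi => ?_
    have hia : a ≠ i := by rintro rfl; simp [h] at hi
    rw [if_pos (Finset.mem_insert_of_mem h), Finset.erase_insert_of_ne hia.symm]
  · rw [Finset.sum_eq_single a]
    · simp [h]
    · intro b _ hb
      rw [if_neg]
      simp [h, hb.symm]
    · simp [h]

/-- A product of differences is invariant under translating all the variables together, so `∑
∂/∂y_i` kills it. In the induction, multiplying by either letter of a new pair gives the same
`lower`, and the difference cancels. -/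
theorem lower_coefSF_pairProd {L : List (Fin n × Fin n)} (hL : (letters L).Nodup) :
    lower 𝕜 (coefSF 𝕜 (pairProd X L)) = 0 := by
  induction L with
  | nil =>
    ext F
    rw [pairProd_nil, ← Finset.prod_empty (f := X), coefSF_prod_X, lower]
    exact Finset.sum_eq_zero fun i _ => by simp
  | cons p L ih =>
    simp only [letters_cons, List.nodup_cons, List.mem_cons, not_or] at hL
    obtain ⟨⟨-, ha⟩, hb, hL⟩ := hL
    have ih := ih hL
    have key : ∀ c, c ∉ letters L →
        lower 𝕜 (coefSF 𝕜 (pairProd X L * X c)) = coefSF 𝕜 (pairProd X L) := by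
      intro c hc
      ext F
      rw [lower_coefSF_mul_X, ih]
      split_ifs with h
      · simp [coefSF_pairProd_eq_zero hL hc h]
      · rfl
    ext F
    have h1 := congrFun (key _ ha) F
    have h2 := congrFun (key _ hb) F
    rw [pairProd_cons, mul_comm, mul_sub, map_sub]
    simp only [lower, Pi.sub_apply, Finset.sum_sub_distrib, Pi.zero_apply] at h1 h2 ⊢
    rw [h1, h2, sub_self]

end SquareFree

/-! ### The span of the products of differences -/

section PairSpan

variable (𝕜 : Type*) [Field 𝕜] (n k : ℕ)

/-- The span of the products of `k` differences of `2 * k` distinct variables. -/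
def pairSpan : Submodule 𝕜 (MvPolynomial (Fin n) 𝕜) :=
  Submodule.span 𝕜 {p | ∃ L : List (Fin n × Fin n),
    (letters L).Nodup ∧ L.length = k ∧ pairProd X L = p}

variable {𝕜 n k}

theorem pairSpan_le_squareFree : pairSpan 𝕜 n k ≤ squareFree 𝕜 n k := by
  rw [pairSpan, Submodule.span_le]
  rintro _ ⟨L, hL, rfl, rfl⟩
  exact pairProd_mem_squareFree hL

theorem map_pairSpan [CharZero 𝕜] :
    (pairSpan 𝕜 n k).map (Ideal.Quotient.mkₐ 𝕜 (I 𝕜 n)).toLinearMap =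
      (gradedPiece 𝕜 n k).toSubmodule := by
  rw [gradedPiece_eq_span_pairProd, pairSpan, Submodule.map_span]
  congr 1
  ext a
  constructor
  · rintro ⟨_, ⟨L, hL, hk, rfl⟩, rfl⟩
    exact ⟨L, hL, hk, (mk_pairProd 𝕜 L).symm⟩
  · rintro ⟨L, hL, hk, rfl⟩
    exact ⟨_, ⟨L, hL, hk, rfl⟩, mk_pairProd 𝕜 L⟩

theorem exists_sub_mem_I [CharZero 𝕜] {p : MvPolynomial (Fin n) 𝕜} (hp : p.IsHomogeneous k) :
    ∃ s ∈ pairSpan 𝕜 n k, p - s ∈ I 𝕜 n := by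
  have : Ideal.Quotient.mk (I 𝕜 n) p ∈ (gradedPiece 𝕜 n k).toSubmodule := ⟨p, hp, rfl⟩
  rw [← map_pairSpan] at this
  obtain ⟨s, hs, h⟩ := this
  exact ⟨s, hs, Ideal.Quotient.eq.1 h.symm⟩

theorem dotProduct_raise_of_mem_pairSpan {v : MvPolynomial (Fin n) 𝕜}
    (hv : v ∈ pairSpan 𝕜 n k) (f : Finset (Fin n) → 𝕜) : coefSF 𝕜 v ⬝ᵥ raise 𝕜 f = 0 := by
  induction hv using Submodule.span_induction with
  | mem x hx =>
    obtain ⟨L, hL, -, rfl⟩ := hx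
    rw [dotProduct_raise, lower_coefSF_pairProd hL, zero_dotProduct]
  | zero => simp
  | add x y _ _ hx hy => rw [map_add, add_dotProduct, hx, hy, add_zero]
  | smul a x _ hx => rw [map_smul, smul_dotProduct, hx, smul_zero]

/-- The square-free coefficient form is nondegenerate on `pairSpan`. -/
theorem eq_zero_of_dotProduct_eq_zero [CharZero 𝕜] {v : MvPolynomial (Fin n) 𝕜}
    (hv : v ∈ pairSpan 𝕜 n k) (h : ∀ s ∈ pairSpan 𝕜 n k, coefSF 𝕜 v ⬝ᵥ coefSF 𝕜 s = 0) :
    v = 0 := by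
  refine eq_zero_of_coefSF_eq_zero (pairSpan_le_squareFree hv) fun B hB => ?_
  -- The coefficient of `v` at `B` is its dot product with `y_B`. Replacing `y_B` by a congruent `s`
  -- in `pairSpan` changes nothing, since `v` is orthogonal to the image of `raise`.
  obtain ⟨s, hs, hsI⟩ := exists_sub_mem_I (hB ▸ isHomogeneous_prod_X 𝕜 B)
  obtain ⟨f, hf⟩ := exists_coefSF_eq_raise 𝕜 hsI
  have h1 : coefSF 𝕜 v ⬝ᵥ coefSF 𝕜 (∏ i ∈ B, X i) = 0 := by
    rw [← sub_add_cancel (∏ i ∈ B, X i) s, map_add, dotProduct_add, h s hs, hf,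
      dotProduct_raise_of_mem_pairSpan hv, add_zero]
  rwa [coefSF_prod_X, dotProduct_single_one] at h1

/-- Such a `v` lies in `pairSpan` and is orthogonal to it, so nondegeneracy applies. -/
theorem raise_eq_zero_of_eq_coefSF [CharZero 𝕜] {v : MvPolynomial (Fin n) 𝕜}
    (hv : v ∈ pairSpan 𝕜 n k) {f : Finset (Fin n) → 𝕜} (hf : coefSF 𝕜 v = raise 𝕜 f) :
    v = 0 := by
  refine eq_zero_of_dotProduct_eq_zero hv fun s hs => ?_
  rw [hf, dotProduct_comm, dotProduct_raise_of_mem_pairSpan hs]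

theorem eq_zero_of_mem_pairSpan_of_mem_I [CharZero 𝕜] {v : MvPolynomial (Fin n) 𝕜}
    (hv : v ∈ pairSpan 𝕜 n k) (hI : v ∈ I 𝕜 n) : v = 0 := by
  obtain ⟨f, hf⟩ := exists_coefSF_eq_raise 𝕜 hI
  exact raise_eq_zero_of_eq_coefSF hv hf

end PairSpan

/-! ### Column antisymmetrizers -/

section Antisymmetrizer

variable (𝕜 : Type*) [Field 𝕜] {n : ℕ}

/-- The product of the operators `1 - (a b)` over a list of pairs `(a, b)`. -/
def antisymm (L : List (Fin n × Fin n)) : Module.End 𝕜 (MvPolynomial (Fin n) 𝕜) :=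
  (L.map fun p => 1 - polyRep 𝕜 n (Equiv.swap p.1 p.2)).prod

theorem antisymm_cons_apply (p : Fin n × Fin n) (L : List (Fin n × Fin n))
    (q : MvPolynomial (Fin n) 𝕜) :
    antisymm 𝕜 (p :: L) q =
      antisymm 𝕜 L q - rename (Equiv.swap p.1 p.2) (antisymm 𝕜 L q) := by
  simp [antisymm, polyRep_apply]

theorem antisymm_concat_apply (p : Fin n × Fin n) (L : List (Fin n × Fin n))
    (q : MvPolynomial (Fin n) 𝕜) :
    antisymm 𝕜 (L ++ [p]) q = antisymm 𝕜 L (q - rename (Equiv.swap p.1 p.2) q) := by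
  simp [antisymm, polyRep_apply]

variable {𝕜}

/-- Permutations preserve the form and a transposition is its own inverse, so each factor `1 - (a
b)` is self-adjoint; taking adjoints reverses their order. -/
theorem dotProduct_antisymm (L : List (Fin n × Fin n)) (q r : MvPolynomial (Fin n) 𝕜) :
    coefSF 𝕜 (antisymm 𝕜 L q) ⬝ᵥ coefSF 𝕜 r =
      coefSF 𝕜 q ⬝ᵥ coefSF 𝕜 (antisymm 𝕜 L.reverse r) := by
  induction L generalizing r with
  | nil => simp [antisymm]
  | cons p L ih =>
    rw [antisymm_cons_apply, List.reverse_cons, antisymm_concat_apply, ← ih, map_sub,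
      sub_dotProduct, map_sub (coefSF 𝕜) r, dotProduct_sub]
    congr 1
    rw [← dotProduct_coefSF_rename 𝕜 (Equiv.swap p.1 p.2) (antisymm 𝕜 L q), rename_rename]
    congr 2
    simp [← Equiv.Perm.coe_mul]

theorem rename_swap_pairProd {a b : Fin n} {L : List (Fin n × Fin n)} (ha : a ∉ letters L)
    (hb : b ∉ letters L) :
    rename (Equiv.swap a b) (pairProd (X : Fin n → MvPolynomial (Fin n) 𝕜) L) = pairProd X L := by
  induction L with
  | nil => simp
  | cons p L ih =>
    simp only [letters_cons, List.mem_cons, not_or] at ha hb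
    rw [pairProd_cons, map_mul, ih ha.2.2 hb.2.2, map_sub, rename_X, rename_X,
      Equiv.swap_apply_of_ne_of_ne (Ne.symm ha.1) (Ne.symm hb.1),
      Equiv.swap_apply_of_ne_of_ne (Ne.symm ha.2.1) (Ne.symm hb.2.1)]

theorem rename_swap_prod_X {a b : Fin n} {C : Finset (Fin n)} (ha : a ∉ C) (hb : b ∉ C) :
    rename (Equiv.swap a b) (∏ i ∈ C, (X i : MvPolynomial (Fin n) 𝕜)) = ∏ i ∈ C, X i := by
  rw [map_prod]
  refine Finset.prod_congr rfl fun i hi => ?_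
  rw [rename_X, Equiv.swap_apply_of_ne_of_ne]
  · rintro rfl; exact ha hi
  · rintro rfl; exact hb hi

/-- The swap fixes `y_C` when `C` contains both or neither of `a`, `b`. Otherwise a factor `±(y_a -
y_b)` splits off. -/
theorem prod_X_sub_rename_swap {a b : Fin n} (hab : a ≠ b) (C : Finset (Fin n)) :
    ∃ c : 𝕜, (∏ i ∈ C, (X i : MvPolynomial (Fin n) 𝕜)) -
        rename (Equiv.swap a b) (∏ i ∈ C, X i) =
        c • ((X a - X b) * ∏ i ∈ (C.erase a).erase b, X i) ∧
      (c ≠ 0 → (C ∩ {a, b}).card = 1) := by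
  have hfix : rename (Equiv.swap a b) (∏ i ∈ (C.erase a).erase b, (X i : MvPolynomial (Fin n) 𝕜))
      = ∏ i ∈ (C.erase a).erase b, X i := rename_swap_prod_X (by simp) (by simp)
  by_cases ha : a ∈ C <;> by_cases hb : b ∈ C
  · refine ⟨0, ?_, by simp⟩
    rw [← Finset.mul_prod_erase C _ ha,
      ← Finset.mul_prod_erase (C.erase a) _ (Finset.mem_erase.2 ⟨hab.symm, hb⟩),
      map_mul, map_mul, hfix]
    simp
    ring
  · refine ⟨1, ?_, fun _ => ?_⟩
    · rw [Finset.erase_eq_of_notMem (a := b) (by simp [hb])] at hfix ⊢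
      rw [← Finset.mul_prod_erase C _ ha, map_mul, hfix]
      simp
      ring
    · rw [Finset.inter_insert_of_mem ha, Finset.inter_singleton_of_notMem hb]; simp
  · refine ⟨-1, ?_, fun _ => ?_⟩
    · rw [Finset.erase_eq_of_notMem ha] at hfix ⊢
      rw [← Finset.mul_prod_erase C _ hb, map_mul, hfix]
      simp
      ring
    · rw [Finset.inter_insert_of_notMem ha, Finset.inter_singleton_of_mem hb]; simp
  · refine ⟨0, ?_, by simp⟩
    rw [rename_swap_prod_X ha hb]
    simp

theorem antisymm_prod_X {L : List (Fin n × Fin n)} (hL : (letters L).Nodup)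
    (B : Finset (Fin n)) :
    ∃ c : 𝕜, antisymm 𝕜 L (∏ i ∈ B, X i) =
        c • (pairProd X L * ∏ i ∈ B \ (letters L).toFinset, X i) ∧
      (c ≠ 0 → (B ∩ (letters L).toFinset).card = L.length) := by
  induction L with
  | nil => exact ⟨1, by simp [antisymm], by simp⟩
  | cons p L ih =>
    simp only [letters_cons, List.nodup_cons, List.mem_cons, not_or] at hL
    obtain ⟨⟨hab, ha⟩, hb, hL⟩ := hL
    obtain ⟨c, hc, hc'⟩ := ih hL
    obtain ⟨e, he, he'⟩ := prod_X_sub_rename_swap (𝕜 := 𝕜) hab (B \ (letters L).toFinset)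
    refine ⟨c * e, ?_, fun h => ?_⟩
    · rw [antisymm_cons_apply, hc, map_smul, map_mul, rename_swap_pairProd ha hb, ← smul_sub,
        ← mul_sub, he, mul_smul_comm, smul_smul, pairProd_cons]
      congr 1
      rw [show B \ (letters (p :: L)).toFinset =
        ((B \ (letters L).toFinset).erase p.1).erase p.2 by
          ext i; simp [and_left_comm]]
      ring
    · have h1 := hc' (left_ne_zero_of_mul h)
      have h2 := he' (right_ne_zero_of_mul h)
      rw [List.length_cons, ← h1, ← h2, ← Finset.card_union_of_disjoint]
      · congr 1
        ext i
        simp only [letters_cons, List.toFinset_cons, Finset.mem_inter, Finset.mem_insert,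
          List.mem_toFinset, Finset.mem_union, Finset.mem_sdiff, Finset.mem_singleton]
        constructor
        · tauto
        · rintro (h | ⟨⟨h, h'⟩, h''⟩) <;> tauto
      · rw [Finset.disjoint_left]
        intro i hi hi'
        simp at hi hi'
        exact hi'.1.2 hi.2

/-- A monomial survives only if it meets the letters of `L` in exactly `k` elements. Having degree
`k`, it then lies wholly in those letters, and no variable is left over beside `pairProd X L`. -/
theorem antisymm_mem_span {k : ℕ} {L : List (Fin n × Fin n)} (hL : (letters L).Nodup)
    (hk : L.length = k) {v : MvPolynomial (Fin n) 𝕜} (hv : v ∈ squareFree 𝕜 n k) :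
    ∃ c : 𝕜, antisymm 𝕜 L v = c • pairProd X L := by
  induction hv using Submodule.span_induction with
  | mem x hx =>
    obtain ⟨B, hB, rfl⟩ := hx
    obtain ⟨c, hc, hc'⟩ := antisymm_prod_X (𝕜 := 𝕜) hL B
    by_cases h0 : c = 0
    · exact ⟨0, by rw [hc, h0, zero_smul, zero_smul]⟩
    · refine ⟨c, ?_⟩
      have h1 : B ∩ (letters L).toFinset = B :=
        Finset.eq_of_subset_of_card_le Finset.inter_subset_left (by rw [hc' h0, hB, hk])
      rw [hc, Finset.sdiff_eq_empty_iff_subset.2 (Finset.inter_eq_left.1 h1)]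
      simp
  | zero => exact ⟨0, by simp⟩
  | add x y _ _ hx hy =>
    obtain ⟨c, hc⟩ := hx
    obtain ⟨e, he⟩ := hy
    exact ⟨c + e, by rw [map_add, hc, he, add_smul]⟩
  | smul a x _ hx =>
    obtain ⟨c, hc⟩ := hx
    exact ⟨a * c, by rw [map_smul, hc, mul_smul]⟩

theorem antisymm_X_mul {a : Fin n} {L : List (Fin n × Fin n)} (ha : a ∉ letters L)
    (q : MvPolynomial (Fin n) 𝕜) : antisymm 𝕜 L (X a * q) = X a * antisymm 𝕜 L q := by
  induction L with
  | nil => simp [antisymm]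
  | cons p L ih =>
    simp only [letters_cons, List.mem_cons, not_or] at ha
    rw [antisymm_cons_apply, antisymm_cons_apply, ih ha.2.2, map_mul, rename_X,
      Equiv.swap_apply_of_ne_of_ne ha.1 ha.2.1, mul_sub]

theorem exists_antisymm_eq_pairProd {L : List (Fin n × Fin n)} (hL : (letters L).Nodup) :
    ∃ q, antisymm 𝕜 L q = pairProd X L := by
  induction L with
  | nil => exact ⟨1, by simp [antisymm]⟩
  | cons p L ih =>
    simp only [letters_cons, List.nodup_cons, List.mem_cons, not_or] at hL
    obtain ⟨⟨-, ha⟩, hb, hL⟩ := hL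
    obtain ⟨q, hq⟩ := ih hL
    -- The preimage built here is the product of the first letters of the pairs.
    refine ⟨X p.1 * q, ?_⟩
    rw [antisymm_cons_apply, antisymm_X_mul ha, hq, map_mul, rename_swap_pairProd ha hb, rename_X,
      Equiv.swap_apply_left, pairProd_cons, sub_mul]

theorem pairProd_reverse {ι A : Type*} [CommRing A] (y : ι → A) (L : List (ι × ι)) :
    pairProd y L.reverse = pairProd y L := by
  rw [pairProd, List.map_reverse, List.prod_reverse, pairProd]

theorem nodup_letters_reverse {ι : Type*} {L : List (ι × ι)} (hL : (letters L).Nodup) :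
    (letters L.reverse).Nodup :=
  ((List.reverse_perm L).flatMap_right _).nodup_iff.2 hL

/-- Each product of differences is the image of some `q` under an antisymmetrizer, so its pairing
with `v` moves to a pairing of `q` with an antisymmetrization of `v`. If all of these vanish, `v` is
orthogonal to `pairSpan`. -/
theorem exists_antisymm_ne_zero [CharZero 𝕜] {k : ℕ} {v : MvPolynomial (Fin n) 𝕜}
    (hv : v ∈ pairSpan 𝕜 n k) (h0 : v ≠ 0) :
    ∃ L : List (Fin n × Fin n), (letters L).Nodup ∧ L.length = k ∧ antisymm 𝕜 L v ≠ 0 := by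
  contrapose! h0
  refine eq_zero_of_dotProduct_eq_zero hv fun s hs => ?_
  induction hs using Submodule.span_induction with
  | mem x hx =>
    obtain ⟨L, hL, hk, rfl⟩ := hx
    obtain ⟨q, hq⟩ := exists_antisymm_eq_pairProd (𝕜 := 𝕜) (nodup_letters_reverse hL)
    rw [dotProduct_comm, ← pairProd_reverse, ← hq, dotProduct_antisymm, List.reverse_reverse,
      h0 L hL hk, map_zero, dotProduct_zero]
  | zero => simp
  | add x y _ _ hx hy => rw [map_add, dotProduct_add, hx, hy, add_zero]
  | smul a x _ hx => rw [map_smul, dotProduct_smul, hx, smul_zero]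

theorem mk_antisymm_mem {W : Submodule 𝕜 (N 𝕜 n)}
    (hW : ∀ σ, ∀ v ∈ W, quotRep 𝕜 n σ v ∈ W) (L : List (Fin n × Fin n))
    {v : MvPolynomial (Fin n) 𝕜} (hv : Ideal.Quotient.mk (I 𝕜 n) v ∈ W) :
    Ideal.Quotient.mk (I 𝕜 n) (antisymm 𝕜 L v) ∈ W := by
  induction L with
  | nil => simpa [antisymm] using hv
  | cons p L ih =>
    rw [antisymm_cons_apply, map_sub, ← quotRep_mk]
    exact W.sub_mem ih (hW _ _ ih)

end Antisymmetrizer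

/-! ### Tableaux with two rows -/

section Tableaux

theorem getElem_letters {ι : Type*} (L : List (ι × ι)) (j : ℕ) (hj : j < L.length) :
    (letters L)[2 * j]'(by rw [length_letters]; omega) = L[j].1 ∧
    (letters L)[2 * j + 1]'(by rw [length_letters]; omega) = L[j].2 := by
  induction L generalizing j with
  | nil => simp at hj
  | cons p L ih =>
    cases j with
    | zero => simp
    | succ j =>
      have := ih j (by simpa using hj)
      simp only [letters_cons, Nat.mul_succ, List.getElem_cons_succ]
      exact this

variable {n k : ℕ} (hk : k ≤ n / 2)

theorem mem_twoRow {c : ℕ × ℕ} :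
    c ∈ (twoRow n k hk).cells ↔ (c.1 = 0 ∧ c.2 < n - k) ∨ (c.1 = 1 ∧ c.2 < k) := by
  obtain ⟨i, j⟩ := c
  rw [YoungDiagram.mem_cells, twoRow, YoungDiagram.mem_ofRowLens]
  match i with
  | 0 => simp
  | 1 => simp
  | i + 2 => simp

theorem cells_twoRow : (twoRow n k hk).cells =
    ({0} ×ˢ Finset.range (n - k)) ∪ ({1} ×ˢ Finset.range k) := by
  ext c
  rw [mem_twoRow]
  simp only [Finset.mem_union, Finset.mem_product, Finset.mem_singleton, Finset.mem_range]

theorem disjoint_rows : Disjoint (({0} : Finset ℕ) ×ˢ Finset.range (n - k))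
    ({1} ×ˢ Finset.range k) := by
  rw [Finset.disjoint_left]
  rintro ⟨i, j⟩ h h'
  simp only [Finset.mem_product, Finset.mem_singleton] at h h'
  omega

theorem card_cells_twoRow : Fintype.card (twoRow n k hk).cells = n := by
  rw [Fintype.card_coe, cells_twoRow, Finset.card_union_of_disjoint disjoint_rows]
  simp
  omega

/-- The cell of the first row in column `j`. -/
def cellZero (j : Fin (n - k)) : (twoRow n k hk).cells :=
  ⟨(0, j), (mem_twoRow hk).2 (Or.inl ⟨rfl, j.2⟩)⟩

/-- The cell of the second row in column `j`. -/
def cellOne (j : Fin k) : (twoRow n k hk).cells := ⟨(1, j), mem_twoRow_one hk j⟩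

theorem cell_cases (c : (twoRow n k hk).cells) :
    (∃ j, c = cellZero hk j) ∨ ∃ j, c = cellOne hk j := by
  obtain ⟨⟨i, j⟩, hc⟩ := c
  rcases (mem_twoRow hk).1 hc with ⟨h, h'⟩ | ⟨h, h'⟩
  · simp only at h h'
    subst h
    exact Or.inl ⟨⟨j, h'⟩, rfl⟩
  · simp only at h h'
    subst h
    exact Or.inr ⟨⟨j, h'⟩, rfl⟩

/-- The columns of height two of a tableau. -/
def columns (T : Tableau (twoRow n k hk) n) : List (Fin n × Fin n) :=
  List.ofFn fun j : Fin k =>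
    (T ⟨(0, j), mem_twoRow_zero hk j⟩, T ⟨(1, j), mem_twoRow_one hk j⟩)

theorem length_columns (T : Tableau (twoRow n k hk) n) : (columns hk T).length = k := by
  simp [columns]

theorem nodup_letters_columns (T : Tableau (twoRow n k hk) n) :
    (letters (columns hk T)).Nodup := by
  rw [letters, List.nodup_flatMap]
  constructor
  · intro p hp
    obtain ⟨j, rfl⟩ := (List.mem_ofFn' _ _).1 hp
    simp
  · rw [columns, List.pairwise_ofFn]
    intro i j hij
    have := hij.ne
    simp [Function.onFun]
    omega

theorem G_eq_pairProd (𝕜 : Type*) [Field 𝕜] (T : Tableau (twoRow n k hk) n) :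
    G 𝕜 hk T = pairProd X (columns hk T) := by
  rw [G, pairProd, columns, List.map_ofFn, List.prod_ofFn]
  rfl

/-- Makes lists of disjoint pairs interchangeable with tableaux: the letters of `L` fill the columns
of height two, and the remaining cells are filled arbitrarily. -/
theorem exists_columns_eq {L : List (Fin n × Fin n)} (hL : (letters L).Nodup)
    (hLk : L.length = k) : ∃ T : Tableau (twoRow n k hk) n, columns hk T = L := by
  classical
  subst hLk
  rcases Nat.eq_zero_or_pos L.length with h0 | h0
  · have e : Nonempty (Tableau (twoRow n L.length hk) n) :=
      ⟨Fintype.equivFinOfCardEq (card_cells_twoRow hk)⟩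
    obtain ⟨T⟩ := e
    refine ⟨T, List.ext_getElem (length_columns hk T) fun j hj hj' => ?_⟩
    omega
  -- `letters L` lists the columns one after another, so row `i` of column `j` sits at position `2 *
  -- j + i`.
  let idx : (twoRow n L.length hk).cells → ℕ := fun c => 2 * c.1.2 + c.1.1
  have hidx : ∀ c : (twoRow n L.length hk).cells, c.1.2 < L.length →
      idx c < (letters L).length := by
    intro c hc
    rw [length_letters]
    have := (mem_twoRow hk).1 c.2
    simp only [idx]
    omega
  -- The default `L[0].1` serves only the cells beyond the columns of height two, where the values
  -- of `f` are discarded; it needs `L` nonempty, hence the earlier case split.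
  let f : (twoRow n L.length hk).cells → Fin n := fun c =>
    (letters L).getD (idx c) (L[0].1)
  have hf : Set.InjOn f ((Finset.univ.filter fun c => c.1.2 < L.length :
      Finset (twoRow n L.length hk).cells) : Set (twoRow n L.length hk).cells) := by
    intro c hc c' hc' h
    simp only [Finset.coe_filter, Finset.mem_univ, true_and, Set.mem_ofPred_eq] at hc hc'
    simp only [f] at h
    rw [List.getD_eq_getElem _ _ (hidx c hc), List.getD_eq_getElem _ _ (hidx c' hc'),
      hL.getElem_inj_iff] at h
    have h1 := (mem_twoRow hk).1 c.2
    have h2 := (mem_twoRow hk).1 c'.2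
    simp only [idx] at h
    ext <;> omega
  obtain ⟨g, hg⟩ := Finset.exists_equiv_extend_of_card_eq (t := (Finset.univ : Finset (Fin n)))
    (by rw [card_cells_twoRow]; simp) (Finset.subset_univ _) hf
  refine ⟨g.trans (Equiv.subtypeUnivEquiv Finset.mem_univ), ?_⟩
  refine List.ext_getElem (length_columns hk _) fun j hj hj' => ?_
  have h := getElem_letters L j hj'
  have hval : ∀ c : (twoRow n L.length hk).cells, c.1.2 < L.length → (g c : Fin n) = f c :=
    fun c hc => hg c (by simpa using hc)
  simp only [columns, List.getElem_ofFn]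
  exact Prod.ext
    ((hval ⟨(0, j), mem_twoRow_zero hk ⟨j, hj'⟩⟩ hj').trans
      ((List.getD_eq_getElem _ _ (hidx _ hj')).trans h.1))
    ((hval ⟨(1, j), mem_twoRow_one hk ⟨j, hj'⟩⟩ hj').trans
      ((List.getD_eq_getElem _ _ (hidx _ hj')).trans h.2))

theorem spechtPolynomial_eq_G (𝕜 : Type*) [Field 𝕜] (T : Tableau (twoRow n k hk) n) :
    spechtPolynomial 𝕜 T = G 𝕜 hk T := by
  rw [spechtPolynomial, G]
  symm
  refine Finset.prod_bij (fun (j : Fin k) _ =>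
    (⟨(0, (j : ℕ)), mem_twoRow_zero hk j⟩, ⟨(1, (j : ℕ)), mem_twoRow_one hk j⟩)) ?_ ?_ ?_ ?_
  · intro j _; simp
  · intro j _ j' _ h
    simpa [Fin.ext_iff] using h
  · rintro ⟨c, c'⟩ h
    simp only [Finset.mem_filter, Finset.mem_univ, true_and] at h
    have h1 := (mem_twoRow hk).1 c.2
    have h2 := (mem_twoRow hk).1 c'.2
    refine ⟨⟨c.1.2, by omega⟩, Finset.mem_univ _, ?_⟩
    ext <;> simp <;> omega
  · intro j _; rfl

theorem toSubmodule_spechtModule (𝕜 : Type*) [Field 𝕜] :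
    (spechtModule 𝕜 (twoRow n k hk) n).toSubmodule = pairSpan 𝕜 n k := by
  change Submodule.span 𝕜 (Set.range _) = Submodule.span 𝕜 _
  refine congrArg _ (Set.ext fun p => ?_)
  constructor
  · rintro ⟨T, rfl⟩
    exact ⟨columns hk T, nodup_letters_columns hk T, length_columns hk T, by
      rw [← G_eq_pairProd, ← spechtPolynomial_eq_G]⟩
  · rintro ⟨L, hL, hLk, rfl⟩
    obtain ⟨T, rfl⟩ := exists_columns_eq hk hL hLk
    exact ⟨T, by simp only [spechtPolynomial_eq_G, G_eq_pairProd]⟩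

theorem rename_pairProd_columns {𝕜 : Type*} [Field 𝕜] (T T' : Tableau (twoRow n k hk) n) :
    rename (T.symm.trans T') (pairProd (X : Fin n → MvPolynomial (Fin n) 𝕜) (columns hk T)) =
      pairProd X (columns hk T') := by
  rw [← G_eq_pairProd, ← G_eq_pairProd, ← spechtPolynomial_eq_G, ← spechtPolynomial_eq_G,
    rename_spechtPolynomial]
  congr 1
  ext c
  simp

end Tableaux

/-! ### Irreducibility and the isomorphism with the Specht module -/

section Irreducible

variable (𝕜 : Type*) [Field 𝕜] {n k : ℕ}

theorem pairProd_ne_zero {L : List (Fin n × Fin n)} (hL : (letters L).Nodup) :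
    pairProd (X : Fin n → MvPolynomial (Fin n) 𝕜) L ≠ 0 := by
  induction L with
  | nil => simp
  | cons p L ih =>
    simp only [letters_cons, List.nodup_cons, List.mem_cons, not_or] at hL
    rw [pairProd_cons]
    refine mul_ne_zero (sub_ne_zero.2 fun h => hL.1.1 (X_injective h)) (ih hL.2.2)

variable [CharZero 𝕜]

/-- The projection from the Specht module onto the graded piece of the quotient. -/
def spechtEquiv (hk : k ≤ n / 2) : (spechtModule 𝕜 (twoRow n k hk) n).toSubmodule ≃ₗ[𝕜]
    (gradedPiece 𝕜 n k).toSubmodule :=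
  LinearEquiv.ofBijective
    ((Ideal.Quotient.mkₐ 𝕜 (I 𝕜 n)).toLinearMap.restrict
      (p := (spechtModule 𝕜 (twoRow n k hk) n).toSubmodule) (fun v hv => by
        rw [toSubmodule_spechtModule] at hv
        rw [← map_pairSpan]
        exact Submodule.mem_map_of_mem hv)) (by
    constructor
    · rw [← LinearMap.ker_eq_bot, LinearMap.ker_eq_bot']
      rintro ⟨v, hv⟩ h
      rw [toSubmodule_spechtModule] at hv
      have h1 := congrArg Subtype.val h
      exact Subtype.ext (eq_zero_of_mem_pairSpan_of_mem_I hv (Ideal.Quotient.eq_zero_iff_mem.1 h1))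
    · rintro ⟨a, ha⟩
      have ha' := ha
      rw [← map_pairSpan] at ha'
      obtain ⟨v, hv, rfl⟩ := ha'
      exact ⟨⟨v, by rw [toSubmodule_spechtModule]; exact hv⟩, rfl⟩)

/-- The graded piece `N^(k)` is isomorphic to the Specht module. -/
def spechtRepEquiv (hk : k ≤ n / 2) : (gradedPiece 𝕜 n k).toRepresentation.Equiv
    (spechtModule 𝕜 (twoRow n k hk) n).toRepresentation :=
  (Representation.Equiv.mk (ρ := (spechtModule 𝕜 (twoRow n k hk) n).toRepresentation)
    (σ := (gradedPiece 𝕜 n k).toRepresentation) (spechtEquiv 𝕜 hk) fun _ =>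
    LinearMap.ext fun _ => Subtype.ext rfl).symm

/-- James's argument: antisymmetrizing a lift of `w` to `pairSpan` puts the class of one product of
differences into `W`; the symmetric group permutes these products transitively, and they span the
graded piece. -/
theorem eq_gradedPiece_of_invariant (hk : k ≤ n / 2) {W : Submodule 𝕜 (N 𝕜 n)}
    (hW : ∀ σ, ∀ v ∈ W, quotRep 𝕜 n σ v ∈ W) {w : N 𝕜 n} (hwW : w ∈ W)
    (hw : w ∈ (gradedPiece 𝕜 n k).toSubmodule) (h0 : w ≠ 0) :
    (gradedPiece 𝕜 n k).toSubmodule ≤ W := by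
  rw [← map_pairSpan] at hw
  obtain ⟨v, hv, rfl⟩ := hw
  obtain ⟨L, hL, hLk, hLv⟩ := exists_antisymm_ne_zero hv (by rintro rfl; exact h0 (map_zero _))
  obtain ⟨c, hc⟩ := antisymm_mem_span hL hLk (pairSpan_le_squareFree hv)
  have hc0 : c ≠ 0 := by rintro rfl; exact hLv (by rw [hc, zero_smul])
  have h1 := mk_antisymm_mem hW L hwW
  rw [hc] at h1
  have h2 : Ideal.Quotient.mk (I 𝕜 n) (pairProd X L) ∈ W := (W.smul_mem_iff hc0).1 h1
  rw [gradedPiece_eq_span_pairProd, Submodule.span_le]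
  rintro _ ⟨L', hL', hLk', rfl⟩
  obtain ⟨T, rfl⟩ := exists_columns_eq hk hL hLk
  obtain ⟨T', rfl⟩ := exists_columns_eq hk hL' hLk'
  rw [SetLike.mem_coe, ← mk_pairProd, ← rename_pairProd_columns hk T T', ← quotRep_mk]
  exact hW _ _ h2

theorem isIrreducible_gradedPiece (hk : k ≤ n / 2) :
    (gradedPiece 𝕜 n k).toRepresentation.IsIrreducible := by
  have hne : ∃ w : (gradedPiece 𝕜 n k).toSubmodule, w ≠ 0 := by
    let T : Tableau (twoRow n k hk) n := Fintype.equivFinOfCardEq (card_cells_twoRow hk)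
    have hT : pairProd X (columns hk T) ∈ (spechtModule 𝕜 (twoRow n k hk) n).toSubmodule := by
      rw [toSubmodule_spechtModule]
      exact Submodule.subset_span ⟨_, nodup_letters_columns hk T, length_columns hk T, rfl⟩
    refine ⟨spechtEquiv 𝕜 hk ⟨_, hT⟩, fun h => ?_⟩
    rw [LinearEquiv.map_eq_zero_iff] at h
    exact pairProd_ne_zero 𝕜 (nodup_letters_columns hk T) (congrArg Subtype.val h)
  obtain ⟨w, hw⟩ := hne
  refine { exists_pair_ne := ⟨⊥, ⊤, fun h => hw ?_⟩, eq_bot_or_eq_top := fun W => ?_ }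
  · have : w ∈ (⊤ : Submodule 𝕜 (gradedPiece 𝕜 n k).toSubmodule) := trivial
    have h' := congrArg Subrepresentation.toSubmodule h
    change (⊥ : Submodule 𝕜 _) = ⊤ at h'
    rwa [← h', Submodule.mem_bot] at this
  · by_cases h : W.toSubmodule = ⊥
    · exact Or.inl (Subrepresentation.toSubmodule_injective h)
    · refine Or.inr (Subrepresentation.toSubmodule_injective ?_)
      obtain ⟨x, hxW, hx0⟩ := Submodule.exists_mem_ne_zero_of_ne_bot h
      have key := eq_gradedPiece_of_invariant 𝕜 hk
        (W := W.toSubmodule.map (gradedPiece 𝕜 n k).toSubmodule.subtype) (w := x) ?_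
        ⟨x, hxW, rfl⟩ x.2 fun h => hx0 (Subtype.ext h)
      · change W.toSubmodule = ⊤
        rw [eq_top_iff]
        rintro y -
        obtain ⟨z, hz, hzy⟩ := key y.2
        rwa [← Subtype.ext (a1 := z) (a2 := y) hzy]
      · rintro σ _ ⟨v, hv, rfl⟩
        exact ⟨_, W.apply_mem_toSubmodule σ hv, rfl⟩

end Irreducible

/-! ### Straightening of square-free monomials -/

section Exchange

variable {ι A 𝕜 : Type*} [DecidableEq ι] [Fintype ι] [CommRing A] [Field 𝕜] [CharZero 𝕜]
  [Algebra 𝕜 A]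

/-- A Garnir-type exchange: `|B₁|! y_{B₁} = (∑_{B₁} y)^|B₁|`, and `∑_{B₁} y` is minus the sum over
`C` and the outside letters. After expansion the pure `C` term is zero because `|C| < |B₁|`, so
every surviving monomial uses an outside letter. -/
theorem prod_mul_prod_mem_of_exchange {y : ι → A} (hy : ∀ i, y i * y i = 0)
    (hs : ∑ i, y i = 0) {B₁ B₂ C : Finset ι} (hdisj : Disjoint B₁ C) (hcard : C.card < B₁.card)
    (hB₂ : B₂ ⊆ (B₁ ∪ C)ᶜ) (W : Submodule 𝕜 A)
    (hW : ∀ F ⊆ C, ∀ G ⊆ (B₁ ∪ C)ᶜ, G.Nonempty → Disjoint G B₂ → F.card + G.card = B₁.card →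
      ∏ i ∈ F ∪ (G ∪ B₂), y i ∈ W) :
    (∏ i ∈ B₁, y i) * ∏ i ∈ B₂, y i ∈ W := by
  have hmono : ∀ F ⊆ C, ∀ G ⊆ (B₁ ∪ C)ᶜ, G.Nonempty → F.card + G.card = B₁.card →
      (∏ i ∈ F, y i) * (∏ i ∈ G, y i) * ∏ i ∈ B₂, y i ∈ W := by
    intro F hF G hG hne hFG
    by_cases hd : Disjoint G B₂
    · have h1 : Disjoint F (G ∪ B₂) := by
        rw [Finset.disjoint_left]
        intro i hi hi'
        have : i ∈ (B₁ ∪ C)ᶜ := by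
          rcases Finset.mem_union.1 hi' with h | h
          exacts [hG h, hB₂ h]
        exact Finset.mem_compl.1 this (Finset.mem_union_right _ (hF hi))
      rw [mul_assoc, ← Finset.prod_union hd, ← Finset.prod_union h1]
      exact hW F hF G hG hne hd hFG
    · obtain ⟨i, hi, hi'⟩ := Finset.not_disjoint_iff.1 hd
      rw [← Finset.mul_prod_erase G _ hi, ← Finset.mul_prod_erase B₂ _ hi']
      convert W.zero_mem using 1
      linear_combination (∏ i ∈ F, y i) * (∏ x ∈ G.erase i, y x) *
        (∏ x ∈ B₂.erase i, y x) * hy i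
  have h0 : ((B₁.card.factorial : ℕ) : 𝕜) ≠ 0 := Nat.cast_ne_zero.2 (Nat.factorial_ne_zero _)
  rw [← W.smul_mem_iff h0, Nat.cast_smul_eq_nsmul, ← smul_mul_assoc, ← sum_pow_card hy]
  have hsum : ∑ i ∈ B₁, y i = -(∑ i ∈ C, y i + ∑ i ∈ (B₁ ∪ C)ᶜ, y i) := by
    have := Finset.sum_add_sum_compl (B₁ ∪ C) y
    rw [hs, Finset.sum_union hdisj] at this
    linear_combination this
  have key : (∑ i ∈ C, y i + ∑ i ∈ (B₁ ∪ C)ᶜ, y i) ^ B₁.card * ∏ i ∈ B₂, y i ∈ W := by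
    rw [add_pow, Finset.sum_mul]
    refine W.sum_mem fun r hr => ?_
    -- `r` is the exponent on the sum over `C`; `r < |B₁|` forces a nonempty `G`, and `r = |B₁|` is
    -- the pure `C` term.
    rcases Nat.lt_succ_iff_lt_or_eq.1 (Finset.mem_range.1 hr) with hr | rfl
    · rw [sum_pow_eq_factorial_nsmul_sum hy, sum_pow_eq_factorial_nsmul_sum hy]
      have : ∀ a b c : A, ∀ p q s : ℕ, (p • a) * (q • b) * (s : A) * c =
          (p * q * s) • (a * b * c) := by
        intro a b c p q s
        simp only [nsmul_eq_mul]
        push_cast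
        ring
      rw [this, Finset.sum_mul_sum, Finset.sum_mul]
      refine W.nsmul_mem (W.sum_mem fun F hF => ?_) _
      rw [Finset.sum_mul]
      refine W.sum_mem fun G hG => ?_
      rw [Finset.mem_powersetCard] at hF hG
      exact hmono F hF.1 G hG.1 (Finset.card_pos.1 (by omega)) (by omega)
    · rw [sum_pow_eq_zero_of_card_lt hy hcard]
      simp
  rw [hsum, neg_pow]
  rcases neg_one_pow_eq_or A B₁.card with h | h <;> rw [h]
  · rwa [one_mul]
  · rw [neg_one_mul, neg_mul]
    exact W.neg_mem key

end Exchange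

/-! ### Binary weights and colexicographic order -/

section Weight

variable {n : ℕ}

/-- The weight of a set of letters, which induces the colexicographic order. -/
def weight (B : Finset (Fin n)) : ℕ := ∑ i ∈ B, 2 ^ (i : ℕ)

theorem weight_eq (B : Finset (Fin n)) : weight B = ∑ i ∈ B.map Fin.valEmbedding, 2 ^ i := by
  simp [weight]

theorem weight_injective : Function.Injective (weight : Finset (Fin n) → ℕ) := by
  intro B C h
  rw [weight_eq, weight_eq] at h
  exact Finset.map_injective _ (Finset.geomSum_injective le_rfl h)

theorem weight_lt {B : Finset (Fin n)} {m : ℕ} (h : ∀ i ∈ B, (i : ℕ) < m) : weight B < 2 ^ m := by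
  rw [weight_eq]
  refine Nat.geomSum_lt le_rfl fun i hi => ?_
  obtain ⟨j, hj, rfl⟩ := Finset.mem_map.1 hi
  exact h j hj

theorem weight_le_weight_univ (B : Finset (Fin n)) :
    weight B ≤ weight (Finset.univ : Finset (Fin n)) :=
  Finset.sum_le_sum_of_subset (Finset.subset_univ _)

theorem weight_union {B C : Finset (Fin n)} (h : Disjoint B C) :
    weight (B ∪ C) = weight B + weight C := Finset.sum_union h

theorem two_pow_le_weight {B : Finset (Fin n)} {i : Fin n} (h : i ∈ B) :
    2 ^ (i : ℕ) ≤ weight B :=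
  Finset.single_le_sum (f := fun i : Fin n => 2 ^ (i : ℕ)) (fun _ _ => Nat.zero_le _) h

end Weight

/-! ### Increasing fillings and straightening -/

section Standard

variable {n k : ℕ} (hk : k ≤ n / 2)

/-- The set of entries of the second row. -/
def secondRow (T : Tableau (twoRow n k hk) n) : Finset (Fin n) :=
  Finset.univ.image fun j => T (cellOne hk j)

theorem card_secondRow (T : Tableau (twoRow n k hk) n) : (secondRow hk T).card = k := by
  rw [secondRow, Finset.card_image_of_injective, Finset.card_fin]
  intro i j h
  simpa [cellOne, Fin.ext_iff] using h

theorem strictMono_cellZero {T : Tableau (twoRow n k hk) n} (hT : IsStandard T) :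
    StrictMono fun j => T (cellZero hk j) := fun _ _ h => hT.1 _ _ rfl h

theorem strictMono_cellOne {T : Tableau (twoRow n k hk) n} (hT : IsStandard T) :
    StrictMono fun j => T (cellOne hk j) := fun _ _ h => hT.1 _ _ rfl h

theorem range_cellOne (T : Tableau (twoRow n k hk) n) :
    Set.range (fun j => T (cellOne hk j)) = secondRow hk T := by
  simp [secondRow]

theorem range_cellZero (T : Tableau (twoRow n k hk) n) :
    Set.range (fun j => T (cellZero hk j)) = (secondRow hk T : Set (Fin n))ᶜ := by
  ext i
  rw [← range_cellOne]
  obtain ⟨c, rfl⟩ := T.surjective i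
  rcases cell_cases hk c with ⟨j, rfl⟩ | ⟨j, rfl⟩
  · simp [cellZero, cellOne]
  · simp [cellZero, cellOne]

theorem secondRow_injective :
    Function.Injective fun T : SYT (twoRow n k hk) n => secondRow hk T.1 := by
  rintro ⟨T, hT⟩ ⟨T', hT'⟩ h
  simp only at h
  have h1 : (fun j => T (cellOne hk j)) = fun j => T' (cellOne hk j) :=
    ((strictMono_cellOne hk hT).range_inj (strictMono_cellOne hk hT')).1 (by
      rw [range_cellOne, range_cellOne, h])
  have h0 : (fun j => T (cellZero hk j)) = fun j => T' (cellZero hk j) :=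
    ((strictMono_cellZero hk hT).range_inj (strictMono_cellZero hk hT')).1 (by
      rw [range_cellZero, range_cellZero, h])
  refine Subtype.ext (Equiv.ext fun c => ?_)
  rcases cell_cases hk c with ⟨j, rfl⟩ | ⟨j, rfl⟩
  · exact congrFun h0 j
  · exact congrFun h1 j

/-- The entries of a set `B` and of its complement, written in increasing order. -/
def fillEntry {B : Finset (Fin n)} (hB : B.card = k) (c : (twoRow n k hk).cells) : Fin n :=
  if h : c.1.1 = 0 then
    Bᶜ.orderEmbOfFin (k := n - k) (by rw [Finset.card_compl, hB, Fintype.card_fin])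
      ⟨c.1.2, by have := (mem_twoRow hk).1 c.2; omega⟩
  else B.orderEmbOfFin hB ⟨c.1.2, by have := (mem_twoRow hk).1 c.2; omega⟩

theorem fillEntry_cellZero {B : Finset (Fin n)} (hB : B.card = k) (j : Fin (n - k)) :
    fillEntry hk hB (cellZero hk j) =
      Bᶜ.orderEmbOfFin (by rw [Finset.card_compl, hB, Fintype.card_fin]) j := rfl

theorem fillEntry_cellOne {B : Finset (Fin n)} (hB : B.card = k) (j : Fin k) :
    fillEntry hk hB (cellOne hk j) = B.orderEmbOfFin hB j := rfl

theorem fillEntry_injective {B : Finset (Fin n)} (hB : B.card = k) :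
    Function.Injective (fillEntry hk hB) := by
  have key : ∀ i j, fillEntry hk hB (cellZero hk i) ≠ fillEntry hk hB (cellOne hk j) := by
    intro i j h
    rw [fillEntry_cellZero, fillEntry_cellOne] at h
    have h1 := Finset.orderEmbOfFin_mem Bᶜ (by rw [Finset.card_compl, hB, Fintype.card_fin]) i
    rw [h, Finset.mem_compl] at h1
    exact h1 (Finset.orderEmbOfFin_mem B hB j)
  intro c c' h
  rcases cell_cases hk c with ⟨i, rfl⟩ | ⟨i, rfl⟩ <;>
    rcases cell_cases hk c' with ⟨j, rfl⟩ | ⟨j, rfl⟩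
  · rw [fillEntry_cellZero, fillEntry_cellZero] at h
    rw [(RelEmbedding.injective _) h]
  · exact absurd h (key i j)
  · exact absurd h.symm (key j i)
  · rw [fillEntry_cellOne, fillEntry_cellOne] at h
    rw [(RelEmbedding.injective _) h]

/-- The tableau with increasing rows whose second row is `B`. -/
def fill {B : Finset (Fin n)} (hB : B.card = k) : Tableau (twoRow n k hk) n :=
  Equiv.ofBijective (fillEntry hk hB) ((Fintype.bijective_iff_injective_and_card _).2
    ⟨fillEntry_injective hk hB, by rw [card_cells_twoRow, Fintype.card_fin]⟩)

theorem fill_cellZero {B : Finset (Fin n)} (hB : B.card = k) (j : Fin (n - k)) :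
    fill hk hB (cellZero hk j) =
      Bᶜ.orderEmbOfFin (by rw [Finset.card_compl, hB, Fintype.card_fin]) j := rfl

theorem fill_cellOne {B : Finset (Fin n)} (hB : B.card = k) (j : Fin k) :
    fill hk hB (cellOne hk j) = B.orderEmbOfFin hB j := rfl

theorem secondRow_fill {B : Finset (Fin n)} (hB : B.card = k) :
    secondRow hk (fill hk hB) = B := by
  rw [← Finset.coe_inj, ← range_cellOne]
  simp only [fill_cellOne]
  exact Finset.range_orderEmbOfFin B hB

theorem isStandard_fill {B : Finset (Fin n)} (hB : B.card = k)
    (h : ∀ j : Fin k, fill hk hB ⟨(0, j), mem_twoRow_zero hk j⟩ <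
      fill hk hB ⟨(1, j), mem_twoRow_one hk j⟩) : IsStandard (fill hk hB) := by
  constructor
  · intro c c' hr hc
    rcases cell_cases hk c with ⟨i, rfl⟩ | ⟨i, rfl⟩ <;>
      rcases cell_cases hk c' with ⟨j, rfl⟩ | ⟨j, rfl⟩
    · rw [fill_cellZero, fill_cellZero]
      exact (OrderEmbedding.strictMono _) hc
    · simp [cellZero, cellOne] at hr
    · simp [cellZero, cellOne] at hr
    · rw [fill_cellOne, fill_cellOne]
      exact (OrderEmbedding.strictMono _) hc
  · intro c c' hc hr
    rcases cell_cases hk c with ⟨i, rfl⟩ | ⟨i, rfl⟩ <;>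
      rcases cell_cases hk c' with ⟨j, rfl⟩ | ⟨j, rfl⟩
    · simp [cellZero] at hr
    · have h1 : cellZero hk i = ⟨(0, j), mem_twoRow_zero hk j⟩ := by
        simp only [cellZero, cellOne] at hc ⊢
        simp [hc]
      rw [h1]
      exact h j
    · simp [cellZero, cellOne] at hr
    · simp [cellOne] at hr

/-- If the increasing filling with second row `B` is not standard, then some initial segment
contains more elements of `B` than of its complement. -/
theorem exists_card_lt_card {B : Finset (Fin n)} (hB : B.card = k)
    (h : ¬ IsStandard (fill hk hB)) :
    ∃ b : Fin n, (Finset.Iic b \ B).card < (B ∩ Finset.Iic b).card := by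
  have : ∃ j : Fin k, fill hk hB ⟨(1, j), mem_twoRow_one hk j⟩ ≤
      fill hk hB ⟨(0, j), mem_twoRow_zero hk j⟩ := by
    by_contra hcon
    push Not at hcon
    exact h (isStandard_fill hk hB hcon)
  obtain ⟨j, hj⟩ := this
  have hjn : (j : ℕ) < n - k := by omega
  have hj' : B.orderEmbOfFin hB j ≤
    Bᶜ.orderEmbOfFin (by rw [Finset.card_compl, hB, Fintype.card_fin]) ⟨j, hjn⟩ := hj
  have hBc : Bᶜ.card = n - k := by rw [Finset.card_compl, hB, Fintype.card_fin]
  -- Take `b` to be the lower entry of a bad column `j`. Up to `b` there are at least `j + 1`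
  -- elements of `B`, but at most `j` of its complement, whose element number `j` lies beyond `b`.
  refine ⟨B.orderEmbOfFin hB j, ?_⟩
  have h1 : (Finset.Iic (B.orderEmbOfFin hB j) \ B).card ≤ j := by
    have hsub : Finset.Iic (B.orderEmbOfFin hB j) \ B ⊆
        (Finset.Iio (⟨j, hjn⟩ : Fin (n - k))).image (Bᶜ.orderEmbOfFin hBc) := by
      intro i hi
      rw [Finset.mem_sdiff, Finset.mem_Iic] at hi
      have hi2 : i ∈ Set.range (Bᶜ.orderEmbOfFin hBc) := by
        rw [Finset.range_orderEmbOfFin]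
        simpa using hi.2
      obtain ⟨l, rfl⟩ := hi2
      refine Finset.mem_image_of_mem _ (Finset.mem_Iio.2 ?_)
      rw [← (Bᶜ.orderEmbOfFin hBc).lt_iff_lt]
      refine lt_of_le_of_ne (hi.1.trans hj') fun heq => hi.2 ?_
      have h3 : B.orderEmbOfFin hB j = Bᶜ.orderEmbOfFin hBc l :=
        le_antisymm (hj'.trans heq.ge) hi.1
      rw [← h3]
      exact Finset.orderEmbOfFin_mem B hB j
    refine (Finset.card_le_card hsub).trans (Finset.card_image_le.trans ?_)
    simp
  have h2 : (j : ℕ) + 1 ≤ (B ∩ Finset.Iic (B.orderEmbOfFin hB j)).card := by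
    have hsub : (Finset.Iic j).image (B.orderEmbOfFin hB) ⊆
        B ∩ Finset.Iic (B.orderEmbOfFin hB j) := by
      intro i hi
      obtain ⟨l, hl, rfl⟩ := Finset.mem_image.1 hi
      rw [Finset.mem_inter, Finset.mem_Iic]
      exact ⟨Finset.orderEmbOfFin_mem B hB l,
        (B.orderEmbOfFin hB).le_iff_le.2 (Finset.mem_Iic.1 hl)⟩
    refine le_trans (le_of_eq ?_) (Finset.card_le_card hsub)
    rw [Finset.card_image_of_injective _ (RelEmbedding.injective _)]
    simp
  omega

variable (𝕜 : Type*) [Field 𝕜] [CharZero 𝕜]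

/-- Downward induction on the weight. For nonstandard `B`, the exchange replaces the part of `B` up
to `b` by sets containing a letter beyond `b`, which strictly raises the weight. -/
theorem prod_varN_mem_span_secondRow (B : Finset (Fin n)) (hB : B.card = k) :
    ∏ i ∈ B, varN 𝕜 i ∈ Submodule.span 𝕜
      (Set.range fun T : SYT (twoRow n k hk) n => ∏ i ∈ secondRow hk T.1, varN 𝕜 i) := by
  induction h : weight (Finset.univ : Finset (Fin n)) - weight B using Nat.strong_induction_on
    generalizing B with
  | _ m ih =>
    by_cases hst : IsStandard (fill hk hB)
    · exact Submodule.subset_span ⟨⟨_, hst⟩, by simp only [secondRow_fill]⟩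
    · obtain ⟨b, hb⟩ := exists_card_lt_card hk hB hst
      have hunion : B ∩ Finset.Iic b ∪ Finset.Iic b \ B = Finset.Iic b := by
        ext i; simp; tauto
      have hsplit : Disjoint (B ∩ Finset.Iic b) (B \ Finset.Iic b) :=
        (Finset.disjoint_sdiff_inter B (Finset.Iic b)).symm
      have hBu : B ∩ Finset.Iic b ∪ B \ Finset.Iic b = B := by
        ext i; simp only [Finset.mem_union, Finset.mem_inter, Finset.mem_sdiff]; tauto
      have hcardB := Finset.card_union_of_disjoint hsplit
      have hwB := weight_union hsplit
      rw [hBu] at hcardB hwB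
      conv in (∏ i ∈ B, varN 𝕜 i) => rw [← hBu, Finset.prod_union hsplit]
      refine prod_mul_prod_mem_of_exchange (varN_mul_self 𝕜) (sum_varN 𝕜)
        (C := Finset.Iic b \ B) ?_ hb ?_ _ ?_
      · rw [Finset.disjoint_left]
        intro i hi hi'
        exact (Finset.mem_sdiff.1 hi').2 (Finset.mem_inter.1 hi).1
      · rw [hunion]
        intro i hi
        exact Finset.mem_compl.2 (Finset.mem_sdiff.1 hi).2
      · intro F hF G hG hne hd hFG
        rw [hunion] at hG
        have hd' : Disjoint F (G ∪ B \ Finset.Iic b) := by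
          rw [Finset.disjoint_left]
          intro i hi hi'
          have h1 := (Finset.mem_sdiff.1 (hF hi)).1
          rcases Finset.mem_union.1 hi' with h | h
          · exact Finset.mem_compl.1 (hG h) h1
          · exact (Finset.mem_sdiff.1 h).2 h1
        refine ih _ ?_ _ ?_ rfl
        -- One letter `g > b` outweighs everything up to `b`: the removed weight is below `2^(b+1) ≤
        -- 2^g`.
        · have h1 : weight (B ∩ Finset.Iic b) < 2 ^ ((b : ℕ) + 1) := weight_lt fun i hi => by
            have := Finset.mem_Iic.1 (Finset.mem_inter.1 hi).2
            exact Nat.lt_succ_of_le this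
          obtain ⟨g, hg⟩ := hne
          have h2 : 2 ^ (g : ℕ) ≤ weight G := two_pow_le_weight hg
          have h3 : (b : ℕ) + 1 ≤ g := by
            have := Finset.mem_compl.1 (hG hg)
            rw [Finset.mem_Iic, not_le] at this
            exact this
          have h4 : 2 ^ ((b : ℕ) + 1) ≤ 2 ^ (g : ℕ) := Nat.pow_le_pow_right (by norm_num) h3
          have h5 := weight_union hd'
          rw [weight_union hd] at h5
          have h6 := weight_le_weight_univ (F ∪ (G ∪ B \ Finset.Iic b))
          omega
        · rw [Finset.card_union_of_disjoint hd', Finset.card_union_of_disjoint hd]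
          omega

theorem gradedPiece_eq_span_secondRow :
    (gradedPiece 𝕜 n k).toSubmodule = Submodule.span 𝕜
      (Set.range fun T : SYT (twoRow n k hk) n => ∏ i ∈ secondRow hk T.1, varN 𝕜 i) := by
  apply le_antisymm
  · rw [gradedPiece_eq_span_prod_varN, Submodule.span_le]
    rintro _ ⟨B, hB, rfl⟩
    exact prod_varN_mem_span_secondRow hk 𝕜 B hB
  · rw [Submodule.span_le]
    rintro _ ⟨T, rfl⟩
    have := prod_varN_mem 𝕜 (secondRow hk T.1)
    rwa [card_secondRow] at this

end Standard

/-! ### The basis of standard products -/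

section Basis

variable {n k : ℕ} (hk : k ≤ n / 2) (𝕜 : Type*) [Field 𝕜]

theorem natDegree_X_pow_sub_X_pow {a b : ℕ} (h : a < b) :
    ((Polynomial.X ^ a - Polynomial.X ^ b : Polynomial 𝕜)).natDegree = b := by
  rw [Polynomial.natDegree_sub_eq_right_of_natDegree_lt] <;> simp [h]

/-- Columns increase downwards in a standard tableau, so in each factor the power attached to the
lower entry dominates. -/
theorem degree_aeval_G (T : SYT (twoRow n k hk) n) :
    (aeval (fun i : Fin n => (Polynomial.X : Polynomial 𝕜) ^ 2 ^ (i : ℕ)) (G 𝕜 hk T.1)).degree =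
      (weight (secondRow hk T.1) : ℕ) := by
  have hlt : ∀ j : Fin k, 2 ^ (T.1 ⟨(0, j), mem_twoRow_zero hk j⟩ : ℕ) <
      2 ^ (T.1 ⟨(1, j), mem_twoRow_one hk j⟩ : ℕ) := fun j =>
    Nat.pow_lt_pow_right (by norm_num) (T.2.2 _ _ rfl (by simp))
  rw [G, map_prod, Polynomial.degree_prod, weight, secondRow, Finset.sum_image, Nat.cast_sum]
  · refine Finset.sum_congr rfl fun j _ => ?_
    rw [map_sub, aeval_X, aeval_X]
    have h := natDegree_X_pow_sub_X_pow 𝕜 (hlt j)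
    rw [Polynomial.degree_eq_natDegree, h]
    · rfl
    · rintro h0
      rw [h0, Polynomial.natDegree_zero] at h
      exact absurd (hlt j) (by rw [← h]; exact Nat.not_lt_zero _)
  · intro i _ j _ h
    simpa [cellOne, Fin.ext_iff] using h

/-- A standard tableau is determined by its second row and a set by its weight, so the substituted
polynomials have pairwise distinct degrees. -/
theorem linearIndependent_G :
    LinearIndependent 𝕜 fun T : SYT (twoRow n k hk) n => G 𝕜 hk T.1 := by
  refine LinearIndependent.of_comp
    (aeval (fun i : Fin n => (Polynomial.X : Polynomial 𝕜) ^ 2 ^ (i : ℕ))).toLinearMap ?_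
  rw [linearIndependent_iff']
  intro s c hc T hT
  by_contra hcT
  have hdeg : ∀ T, c T ≠ 0 → (c T • (aeval (fun i : Fin n =>
      (Polynomial.X : Polynomial 𝕜) ^ 2 ^ (i : ℕ)) (G 𝕜 hk T.1))).degree =
      (weight (secondRow hk T.1) : ℕ) := fun T h => by
    rw [Polynomial.degree_smul_of_smul_regular _ (IsSMulRegular.of_ne_zero h), degree_aeval_G]
  have key := Polynomial.degree_sum_eq_of_disjoint
    (fun T => c T • (aeval (fun i : Fin n =>
      (Polynomial.X : Polynomial 𝕜) ^ 2 ^ (i : ℕ)) (G 𝕜 hk T.1))) s (by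
    rintro T ⟨-, hT⟩ T' ⟨-, hT'⟩ hne h
    simp only [Function.comp_apply] at h
    rw [hdeg T (left_ne_zero_of_smul hT), hdeg T' (left_ne_zero_of_smul hT'), Nat.cast_inj] at h
    exact hne (secondRow_injective hk (weight_injective h)))
  have h0 : (∑ T ∈ s, c T • (aeval (fun i : Fin n =>
      (Polynomial.X : Polynomial 𝕜) ^ 2 ^ (i : ℕ)) (G 𝕜 hk T.1))) = 0 := hc
  rw [h0, Polynomial.degree_zero, eq_comm, Finset.sup_eq_bot_iff] at key
  have := key T hT
  rw [hdeg T hcT] at this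
  exact absurd this (by simp)

variable [CharZero 𝕜]

/-- The class of `G_T` as an element of the graded piece. -/
def classG (T : SYT (twoRow n k hk) n) : (gradedPiece 𝕜 n k).toSubmodule :=
  ⟨Ideal.Quotient.mk (I 𝕜 n) (G 𝕜 hk T.1), by
    have := pairProd_varN_mem 𝕜 (columns hk T.1)
    rwa [length_columns, ← mk_pairProd, ← G_eq_pairProd] at this⟩

theorem linearIndependent_classG : LinearIndependent 𝕜 (classG hk 𝕜) := by
  have hmem : ∀ T : SYT (twoRow n k hk) n,
      G 𝕜 hk T.1 ∈ (spechtModule 𝕜 (twoRow n k hk) n).toSubmodule := fun T =>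
    Submodule.subset_span ⟨T.1, spechtPolynomial_eq_G hk 𝕜 T.1⟩
  have h1 : LinearIndependent 𝕜 fun T : SYT (twoRow n k hk) n =>
      (⟨G 𝕜 hk T.1, hmem T⟩ : (spechtModule 𝕜 (twoRow n k hk) n).toSubmodule) :=
    LinearIndependent.of_comp (spechtModule 𝕜 (twoRow n k hk) n).toSubmodule.subtype
      (linearIndependent_G hk 𝕜)
  exact h1.map' (spechtEquiv 𝕜 hk).toLinearMap (LinearEquiv.ker _)

/-- Straightening bounds the dimension by the number of standard tableaux, and that many classes are
already independent. -/
theorem span_classG : ⊤ ≤ Submodule.span 𝕜 (Set.range (classG hk 𝕜)) := by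
  classical
  have hfin : Module.Finite 𝕜 (gradedPiece 𝕜 n k).toSubmodule := by
    rw [gradedPiece_eq_span_secondRow hk]
    exact Module.Finite.span_of_finite 𝕜 (Set.finite_range _)
  have hle : Module.finrank 𝕜 (gradedPiece 𝕜 n k).toSubmodule ≤
      Fintype.card (SYT (twoRow n k hk) n) := by
    rw [gradedPiece_eq_span_secondRow hk]
    exact finrank_range_le_card _
  have hge := (linearIndependent_classG hk 𝕜).fintype_card_le_finrank
  exact ((linearIndependent_classG hk 𝕜).span_eq_top_of_card_eq_finrank'
    (le_antisymm hge hle)).ge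

/-- The basis of the graded piece given by the classes of the `G_T`. -/
def basisG : Module.Basis (SYT (twoRow n k hk) n) 𝕜 (gradedPiece 𝕜 n k).toSubmodule :=
  Module.Basis.mk (linearIndependent_classG hk 𝕜) (span_classG hk 𝕜)

theorem coe_basisG (T : SYT (twoRow n k hk) n) :
    (basisG hk 𝕜 T : N 𝕜 n) = Ideal.Quotient.mk (I 𝕜 n) (G 𝕜 hk T.1) := by
  rw [basisG, Module.Basis.mk_apply]
  rfl

end Basis

/-! ### The character of a graded piece -/

section Character

theorem trace_funLeft (𝕜 : Type*) [Field 𝕜] {α : Type*} [Fintype α] [DecidableEq α] (g : α → α) :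
    LinearMap.trace 𝕜 (α → 𝕜) (LinearMap.funLeft 𝕜 𝕜 g) = (Nat.card {x // g x = x} : 𝕜) := by
  rw [LinearMap.trace_eq_matrix_trace 𝕜 (Pi.basisFun 𝕜 α), Matrix.trace, Nat.card_eq_fintype_card,
    Fintype.card_subtype, Finset.card_filter, Nat.cast_sum]
  refine Finset.sum_congr rfl fun x _ => ?_
  simp [LinearMap.funLeft_apply, Pi.single_apply]

variable (𝕜 : Type*) [Field 𝕜] {n : ℕ} (P : ℕ → Prop)

/-- The action of `σ⁻¹` on the subsets whose cardinality satisfies `P`. -/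
def invImage (σ : Equiv.Perm (Fin n)) (B : {B : Finset (Fin n) // P B.card}) :
    {B : Finset (Fin n) // P B.card} :=
  ⟨B.1.image ⇑σ⁻¹, by
    rw [Finset.card_image_of_injective _ (Equiv.injective σ⁻¹)]
    exact B.2⟩

/-- Extension of a function by zero. -/
def extendZero : ({B : Finset (Fin n) // P B.card} → 𝕜) →ₗ[𝕜] (Finset (Fin n) → 𝕜) :=
  Function.ExtendByZero.linearMap 𝕜 Subtype.val

theorem extendZero_apply (f : {B : Finset (Fin n) // P B.card} → 𝕜)
    (B : {B : Finset (Fin n) // P B.card}) : extendZero 𝕜 P f B.1 = f B :=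
  Subtype.val_injective.extend_apply f 0 B

theorem extendZero_of_not (f : {B : Finset (Fin n) // P B.card} → 𝕜)
    {B : Finset (Fin n)} (hB : ¬ P B.card) : extendZero 𝕜 P f B = 0 :=
  Function.extend_apply' (f := Subtype.val) f (0 : Finset (Fin n) → 𝕜) B
    (by rintro ⟨C, rfl⟩; exact hB C.2)

theorem image_inv_image (σ : Equiv.Perm (Fin n)) (B : Finset (Fin n)) :
    (B.image ⇑σ⁻¹).image σ = B := by
  rw [Finset.image_image, ← Equiv.Perm.coe_mul, mul_inv_cancel, Equiv.Perm.coe_one,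
    Finset.image_id]

theorem coefSF_rename' (σ : Equiv.Perm (Fin n)) (p : MvPolynomial (Fin n) 𝕜)
    (B : Finset (Fin n)) : coefSF 𝕜 (rename σ p) B = coefSF 𝕜 p (B.image ⇑σ⁻¹) := by
  rw [← coefSF_rename 𝕜 σ p, image_inv_image]

theorem extendZero_funLeft (σ : Equiv.Perm (Fin n)) (f : {B : Finset (Fin n) // P B.card} → 𝕜)
    (B : Finset (Fin n)) :
    extendZero 𝕜 P (LinearMap.funLeft 𝕜 𝕜 (invImage P σ) f) B =
      extendZero 𝕜 P f (B.image ⇑σ⁻¹) := by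
  have hcard : (B.image ⇑σ⁻¹).card = B.card :=
    Finset.card_image_of_injective _ (Equiv.injective σ⁻¹)
  by_cases hB : P B.card
  · rw [extendZero_apply 𝕜 P _ ⟨B, hB⟩, LinearMap.funLeft_apply]
    exact (extendZero_apply 𝕜 P f (invImage P σ ⟨B, hB⟩)).symm
  · rw [extendZero_of_not 𝕜 P _ hB, extendZero_of_not 𝕜 P _ (by rwa [hcard])]

theorem raise_image (f : Finset (Fin n) → 𝕜) (σ : Equiv.Perm (Fin n)) (B : Finset (Fin n)) :
    raise 𝕜 f (B.image σ) = raise 𝕜 (fun C => f (C.image σ)) B := by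
  rw [raise_apply, raise_apply, Finset.sum_image fun _ _ _ _ h => σ.injective h]
  exact Finset.sum_congr rfl fun i _ => by rw [Finset.image_erase σ.injective]

theorem coefSF_mul_prod_X_univ (p : MvPolynomial (Fin n) 𝕜) (F : Finset (Fin n)) :
    coefSF 𝕜 (p * ∏ i ∈ Fᶜ, X i) Finset.univ = coefSF 𝕜 p F := by
  have : indicatorExp (Finset.univ : Finset (Fin n)) = indicatorExp F + indicatorExp Fᶜ := by
    rw [indicatorExp, indicatorExp, indicatorExp, Finset.sum_add_sum_compl]
  rw [coefSF_apply, prod_X_eq_monomial, this, coeff_mul_monomial, mul_one, coefSF_apply]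

theorem coefSF_sum_smul (f : Finset (Fin n) → 𝕜) :
    coefSF 𝕜 (∑ B, f B • ∏ i ∈ B, X i) = f := by
  ext B
  simp [map_sum, coefSF_prod_X, Finset.sum_apply, Pi.single_apply]

variable (k : ℕ)

/-- Multiplication by `∑ i, y_i` from degree `k - 1` to degree `k`, plus the inclusion of the
Specht module. -/
def raiseAdd (hk : k ≤ n / 2) :
    ({B : Finset (Fin n) // B.card + 1 = k} → 𝕜) ×
      (spechtModule 𝕜 (twoRow n k hk) n).toSubmodule →ₗ[𝕜]
    ({B : Finset (Fin n) // B.card = k} → 𝕜) :=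
  LinearMap.funLeft 𝕜 𝕜 Subtype.val ∘ₗ
    ((raise 𝕜 ∘ₗ extendZero 𝕜 (fun m => m + 1 = k)).coprod
      (coefSF 𝕜 ∘ₗ (spechtModule 𝕜 (twoRow n k hk) n).toSubmodule.subtype))

variable {k}

theorem raiseAdd_apply (hk : k ≤ n / 2) (f : {B : Finset (Fin n) // B.card + 1 = k} → 𝕜)
    (s : (spechtModule 𝕜 (twoRow n k hk) n).toSubmodule)
    (B : {B : Finset (Fin n) // B.card = k}) :
    raiseAdd 𝕜 k hk (f, s) B =
      raise 𝕜 (extendZero 𝕜 (fun m => m + 1 = k) f) B.1 + coefSF 𝕜 s.1 B.1 := by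
  simp [raiseAdd, LinearMap.funLeft_apply]

theorem raise_extendZero_of_card_ne (f : {B : Finset (Fin n) // B.card + 1 = k} → 𝕜)
    {B : Finset (Fin n)} (hB : B.card ≠ k) :
    raise 𝕜 (extendZero 𝕜 (fun m => m + 1 = k) f) B = 0 := by
  rw [raise_apply]
  refine Finset.sum_eq_zero fun i hi => extendZero_of_not 𝕜 (fun m => m + 1 = k) f ?_
  rwa [Finset.card_erase_add_one hi]

theorem raise_extendZero_restrict (f : Finset (Fin n) → 𝕜) {B : Finset (Fin n)}
    (hB : B.card = k) :
    raise 𝕜 (extendZero 𝕜 (fun m => m + 1 = k) fun C => f C.1) B = raise 𝕜 f B := by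
  rw [raise_apply, raise_apply]
  refine Finset.sum_congr rfl fun i hi => ?_
  exact extendZero_apply 𝕜 (fun m => m + 1 = k) (fun C => f C.1)
    ⟨B.erase i, by rw [Finset.card_erase_add_one hi, hB]⟩

theorem raiseAdd_comm (hk : k ≤ n / 2) (σ : Equiv.Perm (Fin n)) :
    raiseAdd 𝕜 k hk ∘ₗ
      (LinearMap.funLeft 𝕜 𝕜 (invImage (fun m => m + 1 = k) σ)).prodMap
        ((spechtModule 𝕜 (twoRow n k hk) n).toRepresentation σ) =
      LinearMap.funLeft 𝕜 𝕜 (invImage (fun m => m = k) σ) ∘ₗ raiseAdd 𝕜 k hk := by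
  refine LinearMap.ext fun ⟨f, s⟩ => funext fun B => ?_
  rw [LinearMap.comp_apply, LinearMap.comp_apply, LinearMap.prodMap_apply, raiseAdd_apply,
    LinearMap.funLeft_apply, raiseAdd_apply]
  congr 1
  · have h : extendZero 𝕜 (fun m => m + 1 = k)
        (LinearMap.funLeft 𝕜 𝕜 (invImage (fun m => m + 1 = k) σ) f) =
        fun C => extendZero 𝕜 (fun m => m + 1 = k) f (C.image ⇑σ⁻¹) :=
      funext fun C => extendZero_funLeft 𝕜 (fun m => m + 1 = k) σ f C
    rw [h]
    exact (raise_image 𝕜 _ σ⁻¹ B.1).symm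
  · exact coefSF_rename' 𝕜 σ s.1 B.1

variable [CharZero 𝕜]

/-- For `|F| = k - 1` the complement has more than `n/2` elements, so its monomial is in `I`, that
is, a multiple of `∑ y_i` up to terms with squares. If `p * ∑ y_i` has no square-free terms, neither
has `p * y_{Fᶜ}`, whose coefficient at the full set is that of `p` at `F`. -/
theorem raise_extendZero_injective (hk : k ≤ n / 2)
    {f : {B : Finset (Fin n) // B.card + 1 = k} → 𝕜}
    (hf : raise 𝕜 (extendZero 𝕜 (fun m => m + 1 = k) f) = 0) : f = 0 := by
  ext F
  set p : MvPolynomial (Fin n) 𝕜 :=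
    ∑ B, extendZero 𝕜 (fun m => m + 1 = k) f B • ∏ i ∈ B, X i with hp
  have hpc : coefSF 𝕜 p = extendZero 𝕜 (fun m => m + 1 = k) f := coefSF_sum_smul 𝕜 _
  have h1 : coefSF 𝕜 (p * ∑ i, X i) = 0 := by rw [coefSF_mul_sum_X, hpc, hf]
  have h2 : ∏ i ∈ F.1ᶜ, (X i : MvPolynomial (Fin n) 𝕜) ∈ I 𝕜 n := by
    rw [← Ideal.Quotient.eq_zero_iff_mem, map_prod]
    refine prod_varN_eq_zero 𝕜 ?_
    have := F.2
    rw [Finset.card_compl, Fintype.card_fin]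
    omega
  obtain ⟨q, hq⟩ := exists_coefSF_eq_of_mem_I 𝕜 h2
  have h3 : coefSF 𝕜 (p * ∏ i ∈ F.1ᶜ, X i) = 0 := by
    rw [show p * ∏ i ∈ F.1ᶜ, X i =
      (∏ i ∈ F.1ᶜ, X i - q * ∑ i, X i) * p + p * (∑ i, X i) * q by ring, map_add,
      coefSF_mul_eq_zero 𝕜 hq, coefSF_mul_eq_zero 𝕜 h1, add_zero]
  have h4 := coefSF_mul_prod_X_univ 𝕜 p F.1
  rw [h3, hpc, extendZero_apply 𝕜 (fun m => m + 1 = k) f F] at h4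
  exact h4.symm

/-- The Specht module meets the image of `raise` trivially by nondegeneracy, and `raise` is
injective here. Surjectivity restates that every form of degree `k` is congruent mod `I` to an
element of `pairSpan`. -/
theorem raiseAdd_bijective (hk : k ≤ n / 2) : Function.Bijective (raiseAdd 𝕜 k hk) := by
  constructor
  · rw [← LinearMap.ker_eq_bot, LinearMap.ker_eq_bot']
    rintro ⟨f, s, hs⟩ h
    have hs' := hs
    rw [toSubmodule_spechtModule] at hs'
    have h1 : coefSF 𝕜 s = raise 𝕜 (-extendZero 𝕜 (fun m => m + 1 = k) f) := by
      ext B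
      rw [map_neg, Pi.neg_apply]
      by_cases hB : B.card = k
      · have h2 := congrFun h ⟨B, hB⟩
        rw [raiseAdd_apply] at h2
        exact eq_neg_of_add_eq_zero_right h2
      · rw [raise_extendZero_of_card_ne 𝕜 f hB, coefSF_eq_zero_of_card_ne
          (squareFree_le_homogeneousSubmodule k (pairSpan_le_squareFree hs')) hB, neg_zero]
    have h2 := raise_eq_zero_of_eq_coefSF hs' h1
    subst h2
    rw [map_zero, map_neg, eq_comm, neg_eq_zero] at h1
    have h3 := raise_extendZero_injective 𝕜 hk h1
    subst h3
    rfl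
  · intro g
    set p : MvPolynomial (Fin n) 𝕜 :=
      ∑ B, extendZero 𝕜 (fun m => m = k) g B • ∏ i ∈ B, X i with hp
    have hpc : coefSF 𝕜 p = extendZero 𝕜 (fun m => m = k) g := coefSF_sum_smul 𝕜 _
    have hhom : p ∈ homogeneousSubmodule (Fin n) 𝕜 k := by
      refine Submodule.sum_mem _ fun B _ => ?_
      by_cases hB : B.card = k
      · refine Submodule.smul_mem _ _ ?_
        rw [mem_homogeneousSubmodule, ← hB]
        exact isHomogeneous_prod_X 𝕜 B
      · rw [extendZero_of_not 𝕜 (fun m => m = k) g hB, zero_smul]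
        exact zero_mem _
    obtain ⟨s, hs, hsI⟩ := exists_sub_mem_I hhom
    obtain ⟨f, hf⟩ := exists_coefSF_eq_raise 𝕜 hsI
    refine ⟨(fun C => f C.1, ⟨s, by rwa [toSubmodule_spechtModule]⟩), ?_⟩
    ext B
    rw [raiseAdd_apply, raise_extendZero_restrict 𝕜 f B.2, ← hf, map_sub, hpc, Pi.sub_apply,
      sub_add_cancel]
    exact extendZero_apply 𝕜 (fun m => m = k) g B

theorem card_fixed_invImage (σ : Equiv.Perm (Fin n)) :
    Nat.card {B // invImage P σ B = B} =
      Nat.card {B : Finset (Fin n) // P B.card ∧ B.image σ = B} := by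
  refine Nat.card_congr ⟨fun B => ⟨B.1.1, B.1.2, ?_⟩, fun B => ⟨⟨B.1, B.2.1⟩, ?_⟩,
    fun _ => rfl, fun _ => rfl⟩
  · have h : B.1.1.image ⇑σ⁻¹ = B.1.1 := congrArg Subtype.val B.2
    conv_lhs => rw [← h]
    exact image_inv_image σ _
  · refine Subtype.ext ?_
    change B.1.image ⇑σ⁻¹ = B.1
    conv_lhs => rw [← B.2.2]
    exact image_inv_image σ⁻¹ B.1

/-- `raiseAdd` is an equivariant isomorphism, so traces add; the trace of a permutation action on
functions counts fixed points. -/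
theorem character_gradedPiece (hk : k ≤ n / 2) (σ : Equiv.Perm (Fin n)) :
    (gradedPiece 𝕜 n k).toRepresentation.character σ =
      (Nat.card {B : Finset (Fin n) // B.card = k ∧ B.image σ = B} : 𝕜) -
        (Nat.card {B : Finset (Fin n) // B.card + 1 = k ∧ B.image σ = B} : 𝕜) := by
  have : Module.Finite 𝕜 (spechtModule 𝕜 (twoRow n k hk) n).toSubmodule :=
    Module.Finite.span_of_finite 𝕜 (Set.finite_range _)
  have h1 : (gradedPiece 𝕜 n k).toRepresentation.character σ =
      LinearMap.trace 𝕜 _ ((spechtModule 𝕜 (twoRow n k hk) n).toRepresentation σ) :=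
    congrFun (Representation.char_iso (spechtRepEquiv 𝕜 hk)) σ
  have h2 := LinearMap.trace_prodMap'
    (LinearMap.funLeft 𝕜 𝕜 (invImage (n := n) (fun m => m + 1 = k) σ))
    ((spechtModule 𝕜 (twoRow n k hk) n).toRepresentation σ)
  rw [← LinearMap.trace_conj' _ (LinearEquiv.ofBijective _ (raiseAdd_bijective 𝕜 hk)),
    trace_funLeft, card_fixed_invImage (P := fun m => m + 1 = k)] at h2
  have h3 : (LinearEquiv.ofBijective _ (raiseAdd_bijective 𝕜 hk)).conj
      ((LinearMap.funLeft 𝕜 𝕜 (invImage (fun m => m + 1 = k) σ)).prodMap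
        ((spechtModule 𝕜 (twoRow n k hk) n).toRepresentation σ)) =
      LinearMap.funLeft 𝕜 𝕜 (invImage (fun m => m = k) σ) := by
    refine LinearMap.ext fun x => ?_
    obtain ⟨y, rfl⟩ := (LinearEquiv.ofBijective _ (raiseAdd_bijective 𝕜 hk)).surjective x
    rw [LinearEquiv.conj_apply_apply, LinearEquiv.symm_apply_apply]
    exact LinearMap.congr_fun (raiseAdd_comm 𝕜 hk σ) y
  rw [h3, trace_funLeft, card_fixed_invImage (P := fun m => m = k)] at h2
  rw [h1, h2, add_sub_cancel_left]

end Character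

/-! ### Power sums and colourings -/

section PowerSum

variable (𝕜 : Type*) [Field 𝕜]

theorem coeff_powerSum (m : ℕ) (d : ℕ →₀ ℕ) [Decidable (∃ i, d = Finsupp.single i m)] :
    MvPowerSeries.coeff d (powerSum 𝕜 m) = if ∃ i, d = Finsupp.single i m then 1 else 0 := by
  rw [show MvPowerSeries.coeff d (powerSum 𝕜 m) = powerSum 𝕜 m d from rfl, powerSum]
  congr

/-- Each factor chooses one variable `x_{g i}`. Nonzero exponents make the choice recoverable from
the monomial. -/
theorem coeff_prod_powerSum {ι : Type*} [Fintype ι] {s : ι → ℕ} (hs : ∀ i, s i ≠ 0)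
    (d : ℕ →₀ ℕ) :
    MvPowerSeries.coeff d (∏ i, powerSum 𝕜 (s i)) =
      (Nat.card {g : ι → ℕ // ∑ i, Finsupp.single (g i) (s i) = d} : 𝕜) := by
  classical
  rw [MvPowerSeries.coeff_prod]
  have h1 : ∀ l : ι →₀ (ℕ →₀ ℕ), ∏ i, MvPowerSeries.coeff (l i) (powerSum 𝕜 (s i)) =
      if ∀ i, ∃ c, l i = Finsupp.single c (s i) then 1 else 0 := by
    intro l
    simp only [coeff_powerSum]
    split_ifs with h
    · exact Finset.prod_eq_one fun i _ => by rw [if_pos (h i)]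
    · push Not at h
      obtain ⟨i, hi⟩ := h
      exact Finset.prod_eq_zero (Finset.mem_univ i) (if_neg (by push Not; exact hi))
  simp only [h1]
  rw [Finset.sum_boole]
  congr 1
  rw [← Fintype.card_coe, ← Nat.card_eq_fintype_card]
  symm
  refine Nat.card_eq_of_bijective (fun g => ⟨Finsupp.equivFunOnFinite.symm
    fun i => Finsupp.single (g.1 i) (s i), ?_⟩) ⟨?_, ?_⟩
  · rw [Finset.mem_filter, Finset.mem_finsuppAntidiag]
    exact ⟨⟨by simpa using g.2, Finset.subset_univ _⟩, fun i => ⟨g.1 i, by simp⟩⟩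
  · intro g g' h
    refine Subtype.ext (funext fun i => ?_)
    have h2 := DFunLike.congr_fun (congrArg Subtype.val h) i
    simp only [Finsupp.equivFunOnFinite_symm_apply_apply] at h2
    exact (Finsupp.single_left_inj (hs i)).1 h2
  · rintro ⟨l, hl⟩
    rw [Finset.mem_filter, Finset.mem_finsuppAntidiag] at hl
    choose g hg using hl.2
    refine ⟨⟨g, ?_⟩, Subtype.ext (Finsupp.ext fun i => ?_)⟩
    · rw [← hl.1.1]
      exact Finset.sum_congr rfl fun i _ => (hg i).symm
    · simp [hg i]

end PowerSum

/-! ### Cycles and invariant colourings -/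

section Blocks

variable {n : ℕ} (σ : Equiv.Perm (Fin n))

/-- The cycles of a permutation, fixed points included. -/
abbrev Block : Type := {c // c ∈ σ.cycleFactorsFinset} ⊕ {x // x ∉ σ.support}

/-- The length of a cycle. -/
def blockSize : Block σ → ℕ := Sum.elim (fun c => c.1.support.card) fun _ => 1

/-- The cycle containing a letter. -/
def block (x : Fin n) : Block σ :=
  if h : x ∈ σ.support then
    Sum.inl ⟨σ.cycleOf x, Equiv.Perm.cycleOf_mem_cycleFactorsFinset_iff.2 h⟩
  else Sum.inr ⟨x, h⟩

theorem blockSize_ne_zero (i : Block σ) : blockSize σ i ≠ 0 := by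
  rcases i with ⟨c, hc⟩ | x
  · have := (Equiv.Perm.mem_cycleFactorsFinset_iff.1 hc).1.two_le_card_support
    simp only [blockSize, Sum.elim_inl]
    omega
  · simp [blockSize]

theorem card_filter_block (i : Block σ) :
    (Finset.univ.filter fun x => block σ x = i).card = blockSize σ i := by
  rcases i with ⟨c, hc⟩ | ⟨x, hx⟩
  · simp only [blockSize, Sum.elim_inl]
    congr 1
    ext x
    rw [Finset.mem_filter, block]
    simp only [Finset.mem_univ, true_and]
    constructor
    · intro h
      split_ifs at h with hx
      have h' : σ.cycleOf x = c := by simpa using h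
      rw [← h', Equiv.Perm.mem_support_cycleOf_iff]
      exact ⟨Equiv.Perm.SameCycle.refl _ _, hx⟩
    · intro h
      rw [dif_pos (Equiv.Perm.mem_cycleFactorsFinset_support_le hc h)]
      simp [← Equiv.Perm.cycle_is_cycleOf h hc]
  · simp only [blockSize, Sum.elim_inr]
    rw [Finset.card_eq_one]
    refine ⟨x, ?_⟩
    ext y
    rw [Finset.mem_filter, block]
    simp only [Finset.mem_univ, true_and, Finset.mem_singleton]
    constructor
    · intro h
      split_ifs at h
      simpa using h
    · rintro rfl
      rw [dif_neg hx]

theorem block_surjective : Function.Surjective (block σ) := fun i => by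
  have h : (Finset.univ.filter fun x => block σ x = i).Nonempty := by
    rw [← Finset.card_pos, card_filter_block]
    exact Nat.pos_of_ne_zero (blockSize_ne_zero σ i)
  obtain ⟨x, hx⟩ := h
  exact ⟨x, (Finset.mem_filter.1 hx).2⟩

theorem sum_comp_block {M : Type*} [AddCommMonoid M] (φ : Block σ → M) :
    ∑ x, φ (block σ x) = ∑ i, blockSize σ i • φ i := by
  rw [← Finset.sum_fiberwise (s := Finset.univ) (g := block σ)]
  refine Finset.sum_congr rfl fun i _ => ?_
  rw [← card_filter_block, ← Finset.sum_const]
  exact Finset.sum_congr rfl fun x hx => by rw [(Finset.mem_filter.1 hx).2]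

theorem block_apply (x : Fin n) : block σ (σ x) = block σ x := by
  by_cases hx : x ∈ σ.support
  · have hx' : σ x ∈ σ.support := Equiv.Perm.apply_mem_support.2 hx
    rw [block, dif_pos hx', block, dif_pos hx]
    simp [Equiv.Perm.cycleOf_self_apply]
  · rw [Equiv.Perm.notMem_support.1 hx]

theorem sameCycle_of_block_eq {x y : Fin n} (h : block σ x = block σ y) : σ.SameCycle x y := by
  by_cases hx : x ∈ σ.support <;> by_cases hy : y ∈ σ.support
  · rw [block, dif_pos hx, block, dif_pos hy] at h
    exact (Equiv.Perm.sameCycle_iff_cycleOf_eq_of_mem_support hx hy).2 (by simpa using h)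
  · rw [block, dif_pos hx, block, dif_neg hy] at h
    simp at h
  · rw [block, dif_neg hx, block, dif_pos hy] at h
    simp at h
  · rw [block, dif_neg hx, block, dif_neg hy] at h
    have h' : x = y := by simpa using h
    rw [h']

theorem eq_of_sameCycle {f : Fin n → ℕ} (hf : f ∘ σ = f) {x y : Fin n} (h : σ.SameCycle x y) :
    f x = f y := by
  obtain ⟨m, -, rfl⟩ := h.exists_pow_eq'
  induction m with
  | zero => rfl
  | succ m ih =>
    rw [pow_succ', Equiv.Perm.mul_apply]
    exact (ih ⟨m, by simp⟩).trans (congrFun hf _).symm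

/-- The content of a colouring. -/
def colorContent (f : Fin n → ℕ) : ℕ →₀ ℕ := ∑ i, Finsupp.single (f i) 1

theorem colorContent_comp_block (g : Block σ → ℕ) :
    colorContent (g ∘ block σ) = ∑ i, Finsupp.single (g i) (blockSize σ i) := by
  rw [colorContent]
  refine (sum_comp_block σ fun i => Finsupp.single (g i) 1).trans ?_
  simp

/-- A colouring is invariant under `σ` exactly when it is constant on cycles. -/
theorem card_blockColor (d : ℕ →₀ ℕ) :
    Nat.card {g : Block σ → ℕ // ∑ i, Finsupp.single (g i) (blockSize σ i) = d} =
      Nat.card {f : Fin n → ℕ // f ∘ σ = f ∧ colorContent f = d} := by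
  refine Nat.card_eq_of_bijective (fun g => ⟨g.1 ∘ block σ, ?_, ?_⟩) ⟨?_, ?_⟩
  · ext x
    simp [block_apply]
  · rw [colorContent_comp_block, g.2]
  · intro g g' h
    exact Subtype.ext ((block_surjective σ).injective_comp_right (congrArg Subtype.val h))
  · rintro ⟨f, hf, hd⟩
    have key : (fun i => f (Function.surjInv (block_surjective σ) i)) ∘ block σ = f := by
      ext x
      exact eq_of_sameCycle σ hf (sameCycle_of_block_eq σ (Function.surjInv_eq _ _))
    refine ⟨⟨fun i => f (Function.surjInv (block_surjective σ) i), ?_⟩, Subtype.ext key⟩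
    rw [← colorContent_comp_block, key, hd]

theorem powerSumPerm_eq_prod (𝕜 : Type*) [Field 𝕜] :
    powerSumPerm 𝕜 σ = ∏ i, powerSum 𝕜 (blockSize σ i) := by
  rw [powerSumPerm, Equiv.Perm.parts_partition, Multiset.map_add, Multiset.prod_add,
    Fintype.prod_sum_type, Multiset.map_replicate, Multiset.prod_replicate]
  congr 1
  · rw [Equiv.Perm.cycleType_def, Multiset.map_map]
    exact (Finset.prod_coe_sort σ.cycleFactorsFinset
      fun c => powerSum 𝕜 c.support.card).symm
  · have h : Fintype.card {x // x ∉ σ.support} = Fintype.card (Fin n) - σ.support.card := by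
      rw [Fintype.card_subtype_compl, Fintype.card_coe]
    rw [← h]
    simp only [blockSize, Sum.elim_inr, Finset.prod_const, Finset.card_univ]

theorem coeff_powerSumPerm (𝕜 : Type*) [Field 𝕜] (d : ℕ →₀ ℕ) :
    MvPowerSeries.coeff d (powerSumPerm 𝕜 σ) =
      (Nat.card {f : Fin n → ℕ // f ∘ σ = f ∧ colorContent f = d} : 𝕜) := by
  rw [powerSumPerm_eq_prod, coeff_prod_powerSum 𝕜 (blockSize_ne_zero σ), card_blockColor]

end Blocks

/-! ### Orbits of coloured subsets -/

section Burnside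

variable {n : ℕ} (P : ℕ → Prop) (d : ℕ →₀ ℕ)

/-- Pairs of a subset, whose cardinality satisfies `P`, and a colouring of content `d`. -/
@[ext]
structure ColoredSubset (n : ℕ) where
  /-- The subset. -/
  set : Finset (Fin n)
  /-- The colouring. -/
  color : Fin n → ℕ
  card_set : P set.card
  content_color : colorContent color = d

theorem colorContent_comp (f : Fin n → ℕ) (σ : Equiv.Perm (Fin n)) :
    colorContent (f ∘ σ) = colorContent f :=
  Equiv.sum_comp σ fun i => Finsupp.single (f i) 1

theorem colorContent_apply (f : Fin n → ℕ) (v : ℕ) :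
    colorContent f v = (Finset.univ.filter fun i => f i = v).card := by
  simp [colorContent, Finsupp.finsetSum_apply, Finsupp.single_apply]

instance : MulAction (Equiv.Perm (Fin n)) (ColoredSubset P d n) where
  smul σ x := ⟨x.set.image σ, x.color ∘ ⇑σ⁻¹,
    by rw [Finset.card_image_of_injective _ σ.injective]; exact x.card_set,
    by rw [colorContent_comp]; exact x.content_color⟩
  one_smul x := ColoredSubset.ext (by
    change x.set.image ⇑(1 : Equiv.Perm (Fin n)) = _
    simp) rfl
  mul_smul σ τ x := ColoredSubset.ext (by
    change x.set.image ⇑(σ * τ) = (x.set.image τ).image σ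
    rw [Finset.image_image, Equiv.Perm.coe_mul]) (by
    change x.color ∘ ⇑(σ * τ)⁻¹ = (x.color ∘ ⇑τ⁻¹) ∘ ⇑σ⁻¹
    rw [mul_inv_rev, Equiv.Perm.coe_mul, Function.comp_assoc])

theorem smul_set_eq (σ : Equiv.Perm (Fin n)) (x : ColoredSubset P d n) :
    (σ • x).set = x.set.image σ := rfl

theorem smul_color_eq (σ : Equiv.Perm (Fin n)) (x : ColoredSubset P d n) :
    (σ • x).color = x.color ∘ ⇑σ⁻¹ := rfl

instance : Finite (ColoredSubset P d n) := by
  have hfin : Set.Finite {f : Fin n → ℕ | ∀ i, f i ∈ (d.support : Set ℕ)} :=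
    Set.Finite.pi' fun _ => d.support.finite_toSet
  have : Finite {f : Fin n → ℕ | ∀ i, f i ∈ (d.support : Set ℕ)} := hfin
  refine Finite.of_injective (β := Finset (Fin n) ×
    {f : Fin n → ℕ | ∀ i, f i ∈ (d.support : Set ℕ)})
    (fun x => (x.set, ⟨x.color, fun i => ?_⟩)) fun x y h => ?_
  · rw [Finset.mem_coe, Finsupp.mem_support_iff, ← DFunLike.congr_fun x.content_color,
      colorContent_apply, Finset.card_ne_zero]
    exact ⟨i, by simp⟩
  · simp only [Prod.mk.injEq, Subtype.mk.injEq] at h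
    exact ColoredSubset.ext h.1 h.2

theorem card_fixedBy (σ : Equiv.Perm (Fin n)) :
    Nat.card (MulAction.fixedBy (ColoredSubset P d n) σ) =
      Nat.card {B : Finset (Fin n) // P B.card ∧ B.image σ = B} *
        Nat.card {f : Fin n → ℕ // f ∘ σ = f ∧ colorContent f = d} := by
  have hinv : ∀ f : Fin n → ℕ, f ∘ ⇑σ⁻¹ = f ↔ f ∘ σ = f := by
    intro f
    constructor <;> intro h
    · conv_lhs => rw [← h]
      ext x; simp
    · conv_lhs => rw [← h]
      ext x; simp
  rw [← Nat.card_prod]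
  refine Nat.card_congr ⟨fun x => (⟨x.1.set, x.1.card_set, ?_⟩,
      ⟨x.1.color, ?_, x.1.content_color⟩),
    fun y => ⟨⟨y.1.1, y.2.1, y.1.2.1, y.2.2.2⟩, ?_⟩, fun _ => rfl, fun _ => rfl⟩
  · exact congrArg ColoredSubset.set x.2
  · exact (hinv _).1 (congrArg ColoredSubset.color x.2)
  · exact ColoredSubset.ext y.1.2.2 ((hinv _).2 y.2.2.1)

/-- The content of the restriction of the colouring to the subset. -/
def subContent (x : ColoredSubset P d n) : ℕ →₀ ℕ := ∑ i ∈ x.set, Finsupp.single (x.color i) 1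

theorem subContent_apply (x : ColoredSubset P d n) (v : ℕ) :
    subContent P d x v = (x.set.filter fun i => x.color i = v).card := by
  simp [subContent, Finsupp.finsetSum_apply, Finsupp.single_apply]

theorem degree_subContent (x : ColoredSubset P d n) : (subContent P d x).degree = x.set.card := by
  simp [subContent, map_sum]

theorem subContent_le (x : ColoredSubset P d n) : subContent P d x ≤ d := by
  intro v
  rw [subContent_apply, ← DFunLike.congr_fun x.content_color, colorContent_apply]
  exact Finset.card_le_card (Finset.filter_subset_filter _ (Finset.subset_univ _))

theorem subContent_smul (σ : Equiv.Perm (Fin n)) (x : ColoredSubset P d n) :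
    subContent P d (σ • x) = subContent P d x := by
  rw [subContent, smul_set_eq, smul_color_eq, subContent, Finset.sum_image fun _ _ _ _ h => σ.injective h]
  simp

/-- Together with `d`, the content of the subset fixes how many letters of each colour lie inside
and outside it, so the fibres for `x` and `y` have equal sizes and can be matched. -/
theorem exists_smul_eq {x y : ColoredSubset P d n} (h : subContent P d x = subContent P d y) :
    ∃ σ : Equiv.Perm (Fin n), σ • x = y := by
  classical
  let F : ColoredSubset P d n → Fin n → ℕ × Prop := fun x i => (x.color i, i ∈ x.set)
  have hcard : ∀ x : ColoredSubset P d n, ∀ c : ℕ × Prop, Fintype.card {i // F x i = c} =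
      if c.2 then subContent P d x c.1 else d c.1 - subContent P d x c.1 := by
    rintro x ⟨v, p⟩
    rw [Fintype.card_subtype]
    split_ifs with hp
    · rw [subContent_apply]
      congr 1
      ext i
      simp only [F, Finset.mem_filter, Finset.mem_univ, true_and, Prod.mk.injEq, eq_iff_iff]
      simp only at hp
      tauto
    · simp only at hp
      rw [subContent_apply]
      rw [← DFunLike.congr_fun x.content_color, colorContent_apply, ← Finset.card_sdiff_of_subset
        (Finset.filter_subset_filter _ (Finset.subset_univ _))]
      congr 1
      ext i
      simp only [F, Finset.mem_filter, Finset.mem_univ, true_and, Prod.mk.injEq, eq_iff_iff,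
        Finset.mem_sdiff]
      tauto
  have e : ∀ c, Nonempty ({i // F x i = c} ≃ {i // F y i = c}) := fun c =>
    ⟨Fintype.equivOfCardEq (by rw [hcard, hcard, h])⟩
  let σ : Equiv.Perm (Fin n) := Equiv.ofFiberEquiv fun c => (e c).some
  have hσ : ∀ i, F y (σ i) = F x i := fun i => Equiv.ofFiberEquiv_map _ i
  refine ⟨σ, ColoredSubset.ext ?_ ?_⟩
  · rw [smul_set_eq]
    ext i
    obtain ⟨j, rfl⟩ := σ.surjective i
    have := (Prod.ext_iff.1 (hσ j)).2
    simp only [F, eq_iff_iff] at this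
    simp [this]
  · rw [smul_color_eq]
    ext i
    obtain ⟨j, rfl⟩ := σ.surjective i
    have := (Prod.ext_iff.1 (hσ j)).1
    simp only [F] at this
    simp [this]

theorem toFinsupp_eq_sum (s : Multiset ℕ) :
    (s.map fun v => Finsupp.single v 1).sum = Multiset.toFinsupp s := by
  induction s using Multiset.induction_on with
  | empty => simp
  | cons a s ih => rw [Multiset.map_cons, Multiset.sum_cons, ih, ← Multiset.singleton_add,
      map_add, Multiset.toFinsupp_singleton]

theorem exists_subContent_eq (hd : d.degree = n) {b : ℕ →₀ ℕ} (hb : b ≤ d) (hP : P b.degree) :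
    ∃ x : ColoredSubset P d n, subContent P d x = b := by
  classical
  -- Colours marked by membership: `b` gives the letters in the subset, `d - b` the others. Listing
  -- this multiset in any order gives the coloured subset.
  set s : Multiset (ℕ × Bool) := (Finsupp.toMultiset b).map (fun v => (v, true)) +
    (Finsupp.toMultiset (d - b)).map (fun v => (v, false)) with hs
  have hlen : s.toList.length = n := by
    rw [Multiset.length_toList, hs, Multiset.card_add, Multiset.card_map, Multiset.card_map,
      ← Multiset.card_add, ← map_add, add_tsub_cancel_of_le hb, Finsupp.card_toMultiset, ← hd]
    rfl
  have hsum : ∀ φ : ℕ × Bool → ℕ →₀ ℕ,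
      ∑ i : Fin n, φ (s.toList[(i : ℕ)]'(by rw [hlen]; exact i.2)) =
      ((Finsupp.toMultiset b).map fun v => φ (v, true)).sum +
        ((Finsupp.toMultiset (d - b)).map fun v => φ (v, false)).sum := by
    intro φ
    have h1 : (s.toList.map φ).sum = (s.map φ).sum := by
      rw [← Multiset.sum_coe, ← Multiset.map_coe, Multiset.coe_toList]
    have h2 : (s.map φ).sum = ((Finsupp.toMultiset b).map fun v => φ (v, true)).sum +
        ((Finsupp.toMultiset (d - b)).map fun v => φ (v, false)).sum := by
      rw [hs, Multiset.map_add, Multiset.map_map, Multiset.map_map, Multiset.sum_add]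
      rfl
    rw [← h2, ← h1]
    rw [← List.sum_ofFn]
    congr 1
    refine List.ext_getElem (by rw [List.length_ofFn, List.length_map, hlen]) fun j _ _ => by simp
  let x : Fin n → ℕ × Bool := fun i => s.toList[(i : ℕ)]'(by rw [hlen]; exact i.2)
  have hcol : colorContent (fun i => (x i).1) = d := by
    rw [colorContent, hsum fun p => Finsupp.single p.1 1]
    simp only
    rw [toFinsupp_eq_sum, toFinsupp_eq_sum, Finsupp.toMultiset_toFinsupp,
      Finsupp.toMultiset_toFinsupp, add_tsub_cancel_of_le hb]
  have hsub : ∑ i ∈ Finset.univ.filter (fun i => (x i).2 = true),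
      Finsupp.single (x i).1 1 = b := by
    rw [Finset.sum_filter, hsum fun p => if p.2 = true then Finsupp.single p.1 1 else 0]
    simp [toFinsupp_eq_sum]
  refine ⟨⟨Finset.univ.filter fun i => (x i).2 = true, fun i => (x i).1, ?_, hcol⟩, hsub⟩
  rw [← hsub] at hP
  simpa [map_sum] using hP

theorem card_orbits (hd : d.degree = n) :
    Nat.card (Quotient (MulAction.orbitRel (Equiv.Perm (Fin n)) (ColoredSubset P d n))) =
      Nat.card {b : ℕ →₀ ℕ // b ≤ d ∧ P b.degree} := by
  refine Nat.card_eq_of_bijective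
    (Quotient.lift (fun x => (⟨subContent P d x, subContent_le P d x,
      by rw [degree_subContent]; exact x.card_set⟩ : {b : ℕ →₀ ℕ // b ≤ d ∧ P b.degree})) ?_) ⟨?_, ?_⟩
  · rintro x y ⟨σ, rfl⟩
    exact Subtype.ext (subContent_smul P d σ y)
  · intro x y
    refine Quotient.inductionOn₂ x y fun x y h => Quotient.sound ?_
    obtain ⟨σ, hσ⟩ := exists_smul_eq P d (congrArg Subtype.val h).symm
    exact ⟨σ, hσ⟩
  · rintro ⟨b, hb, hP⟩
    obtain ⟨x, hx⟩ := exists_subContent_eq P d hd hb hP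
    exact ⟨Quotient.mk _ x, Subtype.ext hx⟩

/-- Burnside's lemma for coloured subsets, whose orbits are classified by the content `b` of the
subset. -/
theorem sum_card_mul_card (hd : d.degree = n) :
    ∑ σ : Equiv.Perm (Fin n), Nat.card {B : Finset (Fin n) // P B.card ∧ B.image σ = B} *
        Nat.card {f : Fin n → ℕ // f ∘ σ = f ∧ colorContent f = d} =
      Nat.card {b : ℕ →₀ ℕ // b ≤ d ∧ P b.degree} * n.factorial := by
  classical
  have := Fintype.ofFinite (ColoredSubset P d n)
  have h := MulAction.sum_card_fixedBy_eq_card_orbits_mul_card_group (Equiv.Perm (Fin n))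
    (ColoredSubset P d n)
  rw [Fintype.card_perm, Fintype.card_fin, ← Nat.card_eq_fintype_card, card_orbits P d hd] at h
  rw [← h]
  exact Finset.sum_congr rfl fun σ _ => by rw [← card_fixedBy, Nat.card_eq_fintype_card]

end Burnside

/-! ### Counting ballot contents -/

section Ballot

/-- The number of `b ≤ e` of degree `k`. -/
def countLE (e : ℕ →₀ ℕ) (k : ℤ) : ℤ := ((Finset.Iic e).filter fun b => (b.degree : ℤ) = k).card

/-- The ballot condition: for every `v`, there are at most as many letters `≤ v` in `b` as letters
`< v` in `e - b`. -/
def IsBallot (e b : ℕ →₀ ℕ) : Prop :=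
  ∀ v, ∑ u ∈ Finset.range (v + 1), b u + ∑ u ∈ Finset.range v, b u ≤ ∑ u ∈ Finset.range v, e u

open Classical in
/-- The number of `b ≤ e` of degree `k` that satisfy the ballot condition. -/
def countBallot (e : ℕ →₀ ℕ) (k : ℤ) : ℤ :=
  ((Finset.Iic e).filter fun b => (b.degree : ℤ) = k ∧ IsBallot e b).card

theorem countLE_symm (e : ℕ →₀ ℕ) (k : ℤ) : countLE e (e.degree - k) = countLE e k := by
  have hdeg : ∀ b ≤ e, ((e - b).degree : ℤ) = e.degree - b.degree := by
    intro b hb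
    have := congrArg Finsupp.degree (tsub_add_cancel_of_le hb)
    rw [map_add] at this
    omega
  rw [countLE, countLE, Nat.cast_inj]
  refine Finset.card_nbij' (fun b => e - b) (fun b => e - b) ?_ ?_ ?_ ?_
  · intro b hb
    simp only [Finset.coe_filter, Finset.mem_Iic, Set.mem_ofPred_eq] at hb ⊢
    refine ⟨tsub_le_self, ?_⟩
    rw [hdeg b hb.1]
    omega
  · intro b hb
    simp only [Finset.coe_filter, Finset.mem_Iic, Set.mem_ofPred_eq] at hb ⊢
    refine ⟨tsub_le_self, ?_⟩
    rw [hdeg b hb.1]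
    omega
  · intro b hb
    simp only [Finset.coe_filter, Finset.mem_Iic, Set.mem_ofPred_eq] at hb
    exact tsub_tsub_cancel_of_le hb.1
  · intro b hb
    simp only [Finset.coe_filter, Finset.mem_Iic, Set.mem_ofPred_eq] at hb
    exact tsub_tsub_cancel_of_le hb.1

theorem card_filter_Iic_add_single {e : ℕ →₀ ℕ} {m : ℕ} (he : e m = 0) (c : ℕ)
    (φ : (ℕ →₀ ℕ) → Prop) [DecidablePred φ] :
    ((Finset.Iic (e + Finsupp.single m c)).filter φ).card =
      ∑ i ∈ Finset.range (c + 1),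
        ((Finset.Iic e).filter fun b => φ (b + Finsupp.single m i)).card := by
  rw [← Finset.card_sigma]
  have herase : ∀ b ≤ e + Finsupp.single m c, b.erase m ≤ e ∧ b m ≤ c := by
    intro b hb
    constructor
    · intro v
      have := hb v
      by_cases hv : v = m
      · subst hv; simp
      · rw [Finsupp.erase_ne hv]
        simpa [hv, Ne.symm hv] using this
    · simpa [he] using hb m
  have hle : ∀ b ≤ e, b m = 0 := fun b hb => by
    have := hb m
    omega
  refine Finset.card_nbij' (fun b => ⟨b m, b.erase m⟩) (fun x => x.2 + Finsupp.single m x.1)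
    ?_ ?_ ?_ ?_
  · intro b hb
    simp only [Finset.coe_filter, Finset.mem_Iic, Set.mem_ofPred_eq] at hb
    simp only [Finset.coe_sigma, Set.mem_sigma_iff, Finset.coe_range, Set.mem_Iio,
      Finset.coe_filter, Finset.mem_Iic, Set.mem_ofPred_eq, Finsupp.erase_add_single]
    exact ⟨Nat.lt_succ_of_le (herase b hb.1).2, (herase b hb.1).1, hb.2⟩
  · rintro ⟨i, b⟩ hb
    simp only [Finset.coe_sigma, Set.mem_sigma_iff, Finset.coe_range, Set.mem_Iio,
      Finset.coe_filter, Finset.mem_Iic, Set.mem_ofPred_eq] at hb ⊢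
    exact ⟨add_le_add hb.2.1 (Finsupp.single_mono (Nat.le_of_lt_succ hb.1)), hb.2.2⟩
  · intro b _
    exact Finsupp.erase_add_single m b
  · rintro ⟨i, b⟩ hb
    simp only [Finset.coe_sigma, Set.mem_sigma_iff, Finset.coe_range, Set.mem_Iio,
      Finset.coe_filter, Finset.mem_Iic, Set.mem_ofPred_eq] at hb
    have h0 := hle b hb.2.1
    have h1 : (b + Finsupp.single m i).erase m = b := by
      ext v
      by_cases hv : v = m
      · subst hv; simp [h0]
      · simp [Finsupp.erase_ne hv]
    simp [h0, h1]

theorem countLE_add_single {e : ℕ →₀ ℕ} {m : ℕ} (he : e m = 0) (c : ℕ) (k : ℤ) :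
    countLE (e + Finsupp.single m c) k = ∑ i ∈ Finset.range (c + 1), countLE e (k - i) := by
  rw [countLE, card_filter_Iic_add_single he, Nat.cast_sum]
  refine Finset.sum_congr rfl fun i _ => ?_
  rw [countLE]
  congr 3
  ext b
  rw [map_add, Finsupp.degree_single]
  push_cast
  omega

theorem sum_range_eq_degree {b : ℕ →₀ ℕ} {v : ℕ} (h : ∀ u ∈ b.support, u < v) :
    ∑ u ∈ Finset.range v, b u = b.degree := by
  rw [Finsupp.degree_apply]
  refine (Finset.sum_subset (fun u hu => Finset.mem_range.2 (h u hu)) fun u _ hu => ?_).symm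
  exact Finsupp.notMem_support_iff.1 hu

theorem sum_range_add_single (b : ℕ →₀ ℕ) (m i v : ℕ) :
    ∑ u ∈ Finset.range v, (b + Finsupp.single m i) u =
      ∑ u ∈ Finset.range v, b u + if m < v then i else 0 := by
  simp only [Finsupp.add_apply, Finset.sum_add_distrib, Finsupp.single_apply]
  simp

/-- Let `m` exceed all letters of `e`. The conditions at `v < m` do not change, the one at `v = m`
reads `2|b| + i ≤ |e|`, and those at `v > m` are the hypothesis `h`. -/
theorem isBallot_add_single {e b : ℕ →₀ ℕ} {m c i : ℕ} (he : ∀ u ∈ e.support, u < m)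
    (hb : b ≤ e) (h : 2 * (b.degree + i) ≤ e.degree + c) :
    IsBallot (e + Finsupp.single m c) (b + Finsupp.single m i) ↔
      2 * b.degree + i ≤ e.degree ∧ IsBallot e b := by
  have hbm : ∀ u ∈ b.support, u < m := fun u hu => he u (Finsupp.support_mono hb hu)
  have hE : ∀ v, m ≤ v → ∑ u ∈ Finset.range v, e u = e.degree := fun v hv =>
    sum_range_eq_degree fun u hu => (he u hu).trans_le hv
  have hB : ∀ v, m ≤ v → ∑ u ∈ Finset.range v, b u = b.degree := fun v hv =>
    sum_range_eq_degree fun u hu => (hbm u hu).trans_le hv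
  simp only [IsBallot, sum_range_add_single]
  constructor
  · intro H
    have hm := H m
    rw [hE m le_rfl, hB m le_rfl, hB (m + 1) (by omega)] at hm
    simp only [Nat.lt_succ_self, if_true, lt_irrefl, if_false] at hm
    refine ⟨by omega, fun v => ?_⟩
    have hv := H v
    by_cases hvm : m ≤ v
    · rw [hE v hvm, hB v hvm, hB (v + 1) (by omega)]
      omega
    · rw [if_neg (by omega), if_neg (by omega), if_neg (by omega)] at hv
      omega
  · rintro ⟨hm, H⟩ v
    have hv := H v
    by_cases hvm : m ≤ v
    · rw [hE v hvm, hB v hvm, hB (v + 1) (by omega)]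
      by_cases hvm' : m = v
      · rw [if_pos (by omega), if_neg (by omega), if_neg (by omega)]
        omega
      · rw [if_pos (by omega), if_pos (by omega), if_pos (by omega)]
        omega
    · rw [if_neg (by omega), if_neg (by omega), if_neg (by omega)]
      omega

theorem countBallot_add_single {e : ℕ →₀ ℕ} {m : ℕ} (he : ∀ u ∈ e.support, u < m) (c : ℕ)
    {k : ℤ} (hk : 2 * k ≤ e.degree + c) :
    countBallot (e + Finsupp.single m c) k =
      ∑ i ∈ Finset.range (c + 1),
        if 2 * k - i ≤ e.degree then countBallot e (k - i) else 0 := by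
  classical
  have hem : e m = 0 := by
    by_contra h
    exact lt_irrefl m (he m (Finsupp.mem_support_iff.2 h))
  rw [countBallot, card_filter_Iic_add_single hem, Nat.cast_sum]
  refine Finset.sum_congr rfl fun i _ => ?_
  have key : ∀ b ≤ e, (((b + Finsupp.single m i).degree : ℤ) = k ∧
      IsBallot (e + Finsupp.single m c) (b + Finsupp.single m i)) ↔
      2 * k - i ≤ e.degree ∧ (b.degree : ℤ) = k - i ∧ IsBallot e b := by
    intro b hb
    rw [map_add, Finsupp.degree_single]
    push_cast
    constructor
    · rintro ⟨h1, h2⟩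
      rw [isBallot_add_single he hb (by omega)] at h2
      exact ⟨by omega, by omega, h2.2⟩
    · rintro ⟨h1, h2, h3⟩
      refine ⟨by omega, ?_⟩
      rw [isBallot_add_single he hb (by omega)]
      exact ⟨by omega, h3⟩
  rw [Finset.filter_congr fun b hb => key b (Finset.mem_Iic.1 hb)]
  split_ifs with h
  · simp only [h, true_and]
    rfl
  · simp [h]

/-- Induction on the largest letter. The two recursions differ only in the terms `i < t` excluded by
the ballot condition; these telescope to `countLE e k - countLE e (k - t)`, which vanishes by the
symmetry `b ↦ e - b`. -/
theorem countBallot_eq (e : ℕ →₀ ℕ) :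
    ∀ k : ℤ, 2 * k ≤ e.degree → countBallot e k = countLE e k - countLE e (k - 1) := by
  induction e using Finsupp.induction_on_max₂ with
  | zero =>
    intro k hk
    have h1 : ∀ v, countLE 0 v = if v = 0 then 1 else 0 := by
      intro v
      rw [countLE, show Finset.Iic (0 : ℕ →₀ ℕ) = {0} by ext b; simp]
      by_cases hv : v = 0
      · simp [hv, Finset.filter_singleton]
      · simp [hv, Finset.filter_singleton, Ne.symm hv]
    have h2 : countBallot 0 k = if k = 0 then 1 else 0 := by
      rw [countBallot, show Finset.Iic (0 : ℕ →₀ ℕ) = {0} by ext b; simp]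
      by_cases hv : k = 0
      · rw [Finset.filter_singleton, if_pos ⟨by simp [hv], fun v => by simp⟩]
        simp [hv]
      · simp [hv, Finset.filter_singleton, Ne.symm hv]
    simp only [map_zero, Nat.cast_zero] at hk
    rw [h1, h1, h2, if_neg (show ¬ k - 1 = 0 by omega), sub_zero]
  | add_single m c e he hc ih =>
    intro k hk
    rw [map_add, Finsupp.degree_single] at hk
    push_cast at hk
    have hem : e m = 0 := by
      by_contra h
      exact lt_irrefl m (he m (Finsupp.mem_support_iff.2 h))
    rw [countBallot_add_single he c hk, countLE_add_single hem, countLE_add_single hem,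
      ← Finset.sum_sub_distrib, eq_comm, ← sub_eq_zero, ← Finset.sum_sub_distrib]
    -- The condition `2 * k - i ≤ |e|` fails exactly for `i < t`.
    set t := (2 * k - e.degree).toNat with ht
    have htc : t ≤ c := by omega
    calc _ = ∑ i ∈ Finset.range (c + 1),
          if i < t then (countLE e (k - i) - countLE e (k - (i + 1 : ℕ))) else 0 := by
          refine Finset.sum_congr rfl fun i _ => ?_
          have harg : k - 1 - (i : ℤ) = k - (i + 1 : ℕ) := by push_cast; ring
          have harg' : k - (i : ℤ) - 1 = k - (i + 1 : ℕ) := by push_cast; ring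
          by_cases hi : i < t
          · rw [if_pos hi, if_neg (by omega), harg, sub_zero]
          · rw [if_neg hi, if_pos (by omega), ih _ (by omega), harg, harg', sub_self]
      _ = ∑ i ∈ Finset.range t, (countLE e (k - i) - countLE e (k - (i + 1 : ℕ))) := by
          rw [← Finset.sum_filter]
          congr 1
          ext i
          simp only [Finset.mem_filter, Finset.mem_range]
          omega
      _ = countLE e k - countLE e (k - t) := by
          have := Finset.sum_range_sub' (fun i : ℕ => countLE e (k - i)) t
          simpa using this
      _ = 0 := by
          by_cases h0 : t = 0
          · rw [h0]; simp
          -- For `t > 0` no truncation occurs, so `t = 2 * k - |e|` and `k - t` is the mirror image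
          -- of `k`.
          · rw [show k - (t : ℤ) = e.degree - k by omega, countLE_symm, sub_self]

end Ballot

/-! ### Semistandard tableaux with two rows -/

section Semistandard

/-- The content of the sequence `r 0, …, r (m - 1)`. -/
def seqContent (m : ℕ) (r : ℕ → ℕ) : ℕ →₀ ℕ := ∑ j ∈ Finset.range m, Finsupp.single (r j) 1

theorem degree_seqContent (m : ℕ) (r : ℕ → ℕ) : (seqContent m r).degree = m := by
  simp [seqContent, map_sum]

theorem sum_range_seqContent (m : ℕ) (r : ℕ → ℕ) (v : ℕ) :
    ∑ u ∈ Finset.range v, seqContent m r u = ((Finset.range m).filter fun j => r j < v).card := by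
  simp only [seqContent, Finsupp.finsetSum_apply, Finsupp.single_apply]
  rw [Finset.sum_comm, Finset.card_filter]
  refine Finset.sum_congr rfl fun j _ => ?_
  simp

/-- In a weakly increasing sequence the entries below `v` form an initial segment, so `r j < v` says
that segment is longer than `j`. -/
theorem lt_iff_lt_sum_seqContent {m : ℕ} {r : ℕ → ℕ}
    (hr : ∀ i j, i ≤ j → j < m → r i ≤ r j) {j : ℕ} (hj : j < m) (v : ℕ) :
    r j < v ↔ j < ∑ u ∈ Finset.range v, seqContent m r u := by
  rw [sum_range_seqContent]
  constructor
  · intro h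
    have hsub : Finset.range (j + 1) ⊆ (Finset.range m).filter fun i => r i < v := by
      intro i hi
      rw [Finset.mem_range] at hi
      rw [Finset.mem_filter, Finset.mem_range]
      exact ⟨by omega, (hr i j (by omega) hj).trans_lt h⟩
    have := Finset.card_le_card hsub
    rw [Finset.card_range] at this
    omega
  · intro h
    by_contra hv
    push Not at hv
    have hsub : ((Finset.range m).filter fun i => r i < v) ⊆ Finset.range j := by
      intro i hi
      rw [Finset.mem_filter, Finset.mem_range] at hi
      rw [Finset.mem_range]
      by_contra hij
      have := hr j i (by omega) hi.1
      omega
    have := Finset.card_le_card hsub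
    rw [Finset.card_range] at this
    omega

theorem eq_of_seqContent_eq {m : ℕ} {r r' : ℕ → ℕ} (hr : ∀ i j, i ≤ j → j < m → r i ≤ r j)
    (hr' : ∀ i j, i ≤ j → j < m → r' i ≤ r' j) (h : seqContent m r = seqContent m r') {j : ℕ}
    (hj : j < m) : r j = r' j := by
  have key : ∀ v, r j < v ↔ r' j < v := fun v => by
    rw [lt_iff_lt_sum_seqContent hr hj, lt_iff_lt_sum_seqContent hr' hj, h]
  have h1 := (key (r j + 1)).1 (Nat.lt_succ_self _)
  have h2 := (key (r' j + 1)).2 (Nat.lt_succ_self _)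
  omega

theorem exists_seqContent_eq {m : ℕ} {b : ℕ →₀ ℕ} (hb : b.degree = m) :
    ∃ r : ℕ → ℕ, (∀ i j, i ≤ j → j < m → r i ≤ r j) ∧ seqContent m r = b := by
  set l := (Finsupp.toMultiset b).sort (· ≤ ·) with hl
  have hlen : l.length = m := by
    rw [hl, Multiset.length_sort, Finsupp.card_toMultiset, ← hb]
    rfl
  refine ⟨fun j => l.getD j 0, ?_, ?_⟩
  · intro i j hij hj
    simp only
    rw [List.getD_eq_getElem _ _ (show i < l.length by omega), List.getD_eq_getElem _ _ (show j < l.length by omega)]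
    have hs : l.Pairwise (· ≤ ·) := Multiset.pairwise_sort _ _
    rcases hij.lt_or_eq with h | rfl
    · exact List.pairwise_iff_getElem.1 hs i j (by omega) (by omega) h
    · exact le_rfl
  · rw [seqContent, ← Finsupp.toMultiset_toFinsupp b, ← toFinsupp_eq_sum,
      ← Multiset.sort_eq (Finsupp.toMultiset b) (· ≤ ·), ← hl, Multiset.map_coe, Multiset.sum_coe,
      Finset.sum_range, ← List.sum_ofFn]
    congr 1
    refine List.ext_getElem (by simp [hlen]) fun j h1 h2 => ?_
    have : j < l.length := by simpa using h2
    simp [this]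

variable {n k : ℕ} (hk : k ≤ n / 2)

theorem content_eq (T : SemistandardYoungTableau (twoRow n k hk)) :
    content T = seqContent (n - k) (T 0) + seqContent k (T 1) := by
  rw [content, cells_twoRow, Finset.sum_union disjoint_rows]
  simp [seqContent]

theorem mono_row (T : SemistandardYoungTableau (twoRow n k hk)) :
    (∀ i j, i ≤ j → j < n - k → T 0 i ≤ T 0 j) ∧ ∀ i j, i ≤ j → j < k → T 1 i ≤ T 1 j :=
  ⟨fun _ _ hij hj => T.row_weak_of_le hij
      ((YoungDiagram.mem_cells _).1 ((mem_twoRow hk).2 (Or.inl ⟨rfl, hj⟩))),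
    fun _ _ hij hj => T.row_weak_of_le hij
      ((YoungDiagram.mem_cells _).1 ((mem_twoRow hk).2 (Or.inr ⟨rfl, hj⟩)))⟩

/-- After cancelling the second row, the ballot condition says that at most as many entries of `r'`
are `≤ v` as entries of `r` are `< v`; for sorted rows this is column strictness. -/
theorem isBallot_iff_forall_lt {m m' : ℕ} (hm : m' ≤ m) {r r' : ℕ → ℕ}
    (hr : ∀ i j, i ≤ j → j < m → r i ≤ r j) (hr' : ∀ i j, i ≤ j → j < m' → r' i ≤ r' j) :
    IsBallot (seqContent m r + seqContent m' r') (seqContent m' r') ↔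
      ∀ j < m', r j < r' j := by
  simp only [IsBallot, Finsupp.add_apply, Finset.sum_add_distrib, add_le_add_iff_right]
  constructor
  · intro H j hj
    rw [lt_iff_lt_sum_seqContent hr (by omega)]
    exact ((lt_iff_lt_sum_seqContent hr' hj _).1 (Nat.lt_succ_self _)).trans_le (H (r' j))
  · intro H v
    rw [sum_range_seqContent, sum_range_seqContent]
    refine Finset.card_le_card fun j hj => ?_
    rw [Finset.mem_filter, Finset.mem_range] at hj ⊢
    have := H j hj.1
    exact ⟨by omega, by omega⟩

/-- The semistandard tableau with given rows. -/
def ofRows {r r' : ℕ → ℕ} (hr : ∀ i j, i ≤ j → j < n - k → r i ≤ r j)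
    (hr' : ∀ i j, i ≤ j → j < k → r' i ≤ r' j) (h : ∀ j < k, r j < r' j) :
    SemistandardYoungTableau (twoRow n k hk) where
  entry i j := if i = 0 ∧ j < n - k then r j else if i = 1 ∧ j < k then r' j else 0
  row_weak' {i j₁ j₂} hj hc := by
    rcases (mem_twoRow hk).1 ((YoungDiagram.mem_cells _).2 hc) with ⟨h1, h2⟩ | ⟨h1, h2⟩
    · simp only at h1 h2
      rw [if_pos ⟨h1, by omega⟩, if_pos ⟨h1, h2⟩]
      exact hr _ _ hj.le h2
    · simp only at h1 h2
      rw [if_neg (by omega), if_pos ⟨h1, by omega⟩, if_neg (by omega), if_pos ⟨h1, h2⟩]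
      exact hr' _ _ hj.le h2
  col_strict' {i₁ i₂ j} hi hc := by
    rcases (mem_twoRow hk).1 ((YoungDiagram.mem_cells _).2 hc) with ⟨h1, h2⟩ | ⟨h1, h2⟩
    · simp only at h1
      omega
    · simp only at h1 h2
      rw [if_pos (by omega), if_neg (by omega), if_pos ⟨h1, h2⟩]
      exact h j h2
  zeros' {i j} hc := by
    rw [← YoungDiagram.mem_cells, mem_twoRow, not_or] at hc
    rw [if_neg hc.1, if_neg hc.2]

theorem ofRows_zero {r r' : ℕ → ℕ} (hr : ∀ i j, i ≤ j → j < n - k → r i ≤ r j)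
    (hr' : ∀ i j, i ≤ j → j < k → r' i ≤ r' j) (h : ∀ j < k, r j < r' j) {j : ℕ}
    (hj : j < n - k) : ofRows hk hr hr' h 0 j = r j := by
  change (if 0 = 0 ∧ j < n - k then r j else if 0 = 1 ∧ j < k then r' j else 0) = r j
  rw [if_pos ⟨rfl, hj⟩]

theorem ofRows_one {r r' : ℕ → ℕ} (hr : ∀ i j, i ≤ j → j < n - k → r i ≤ r j)
    (hr' : ∀ i j, i ≤ j → j < k → r' i ≤ r' j) (h : ∀ j < k, r j < r' j) {j : ℕ}
    (hj : j < k) : ofRows hk hr hr' h 1 j = r' j := by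
  change (if 1 = 0 ∧ j < n - k then r j else if 1 = 1 ∧ j < k then r' j else 0) = r' j
  rw [if_neg (by simp), if_pos ⟨rfl, hj⟩]

/-- A tableau is recovered from the content `b` of its second row: `d - b` is the content of the
first, and weakly increasing rows are determined by their contents. -/
theorem card_semistandard_eq_card_ballot {d : ℕ →₀ ℕ} (hd : d.degree = n) :
    Nat.card {T : SemistandardYoungTableau (twoRow n k hk) // content T = d} =
      Nat.card {b : ℕ →₀ ℕ // b ≤ d ∧ b.degree = k ∧ IsBallot d b} := by
  have hkk : k ≤ n - k := by omega
  refine Nat.card_eq_of_bijective (fun T => ⟨seqContent k (T.1 1), ?_, degree_seqContent _ _, ?_⟩)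
    ⟨?_, ?_⟩
  · exact le_add_self.trans_eq ((content_eq hk T.1).symm.trans T.2)
  · have h := (isBallot_iff_forall_lt hkk (mono_row hk T.1).1 (mono_row hk T.1).2).2 fun j hj =>
      T.1.col_strict Nat.zero_lt_one
        ((YoungDiagram.mem_cells _).1 ((mem_twoRow hk).2 (Or.inr ⟨rfl, hj⟩)))
    rwa [← content_eq, T.2] at h
  · intro T T' h
    have h1 : seqContent k (T.1 1) = seqContent k (T'.1 1) := congrArg Subtype.val h
    have h0 : seqContent (n - k) (T.1 0) = seqContent (n - k) (T'.1 0) := by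
      have := (content_eq hk T.1).symm.trans (T.2.trans (T'.2.symm.trans (content_eq hk T'.1)))
      rw [h1] at this
      exact add_right_cancel this
    refine Subtype.ext (SemistandardYoungTableau.ext fun i j => ?_)
    by_cases hc : (i, j) ∈ (twoRow n k hk).cells
    · rcases (mem_twoRow hk).1 hc with ⟨hi, hj⟩ | ⟨hi, hj⟩
      · simp only at hi hj
        subst hi
        exact eq_of_seqContent_eq (mono_row hk T.1).1 (mono_row hk T'.1).1 h0 hj
      · simp only at hi hj
        subst hi
        exact eq_of_seqContent_eq (mono_row hk T.1).2 (mono_row hk T'.1).2 h1 hj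
    · rw [YoungDiagram.mem_cells] at hc
      rw [T.1.zeros hc, T'.1.zeros hc]
  · rintro ⟨b, hb, hbk, hbal⟩
    have hdb : (d - b).degree = n - k := by
      have := congrArg Finsupp.degree (tsub_add_cancel_of_le hb)
      rw [map_add] at this
      omega
    obtain ⟨r, hr, hrb⟩ := exists_seqContent_eq hdb
    obtain ⟨r', hr', hrb'⟩ := exists_seqContent_eq hbk
    have hlt : ∀ j < k, r j < r' j := by
      rw [← isBallot_iff_forall_lt hkk hr hr', hrb, hrb', tsub_add_cancel_of_le hb]
      exact hbal
    have e0 : seqContent (n - k) (ofRows hk hr hr' hlt 0) = d - b := by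
      rw [← hrb]
      exact Finset.sum_congr rfl fun j hj => by
        rw [ofRows_zero hk hr hr' hlt (Finset.mem_range.1 hj)]
    have e1 : seqContent k (ofRows hk hr hr' hlt 1) = b := by
      rw [← hrb']
      exact Finset.sum_congr rfl fun j hj => by
        rw [ofRows_one hk hr hr' hlt (Finset.mem_range.1 hj)]
    exact ⟨⟨ofRows hk hr hr' hlt, by
      rw [content_eq, e0, e1, tsub_add_cancel_of_le hb]⟩, Subtype.ext e1⟩

theorem card_semistandard {d : ℕ →₀ ℕ} (hd : d.degree = n) :
    (Nat.card {T : SemistandardYoungTableau (twoRow n k hk) // content T = d} : ℤ) =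
      Nat.card {b : ℕ →₀ ℕ // b ≤ d ∧ b.degree = k} -
        Nat.card {b : ℕ →₀ ℕ // b ≤ d ∧ b.degree + 1 = k} := by
  classical
  have hcard : ∀ φ : (ℕ →₀ ℕ) → Prop, (Nat.card {b : ℕ →₀ ℕ // b ≤ d ∧ φ b}) =
      ((Finset.Iic d).filter φ).card := by
    intro φ
    rw [← Fintype.card_coe, ← Nat.card_eq_fintype_card]
    exact Nat.card_congr (Equiv.subtypeEquivRight fun b => by simp)
  have c1 : countBallot d k =
      Nat.card {b : ℕ →₀ ℕ // b ≤ d ∧ b.degree = k ∧ IsBallot d b} := by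
    rw [countBallot, hcard, Nat.cast_inj]
    exact congrArg Finset.card (Finset.ext fun b => by simp only [Finset.mem_filter, Nat.cast_inj])
  have c2 : countLE d k = Nat.card {b : ℕ →₀ ℕ // b ≤ d ∧ b.degree = k} := by
    rw [countLE, hcard, Nat.cast_inj]
    exact congrArg Finset.card (Finset.ext fun b => by simp only [Finset.mem_filter, Nat.cast_inj])
  have c3 : countLE d (k - 1) = Nat.card {b : ℕ →₀ ℕ // b ≤ d ∧ b.degree + 1 = k} := by
    rw [countLE, hcard, Nat.cast_inj]
    refine congrArg Finset.card (Finset.ext fun b => ?_)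
    simp only [Finset.mem_filter]
    exact and_congr_right fun _ => by omega
  rw [card_semistandard_eq_card_ballot hk hd, ← c1, ← c2, ← c3]
  exact countBallot_eq d k (by omega)

theorem isEmpty_semistandard {d : ℕ →₀ ℕ} (hd : d.degree ≠ n) :
    IsEmpty {T : SemistandardYoungTableau (twoRow n k hk) // content T = d} := by
  refine ⟨fun T => hd ?_⟩
  rw [← T.2, content_eq, map_add, degree_seqContent, degree_seqContent]
  omega

end Semistandard

/-! ### The graded Frobenius characteristic -/

section Frobenius

variable (𝕜 : Type*) [Field 𝕜] [CharZero 𝕜] {n k : ℕ}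

theorem degree_colorContent (f : Fin n → ℕ) : (colorContent f).degree = n := by
  simp [colorContent, map_sum]

/-- Coefficients are compared at each `d`: Burnside's lemma evaluates the two sums coming from the
character, and their difference is the semistandard count. When `|d| ≠ n`, there are neither
colourings nor tableaux of content `d`. -/
theorem frob_gradedPiece (hk : k ≤ n / 2) :
    frob (gradedPiece 𝕜 n k).toRepresentation = schur 𝕜 (twoRow n k hk) := by
  ext d
  have hschur : MvPowerSeries.coeff d (schur 𝕜 (twoRow n k hk)) =
      (Nat.card {T : SemistandardYoungTableau (twoRow n k hk) // content T = d} : 𝕜) := rfl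
  rw [hschur, frob, map_smul, map_sum, smul_eq_mul]
  simp only [map_smul, smul_eq_mul, character_gradedPiece 𝕜 hk, coeff_powerSumPerm]
  by_cases hd : d.degree = n
  · have hint := card_semistandard hk hd
    have hcast := congrArg (Int.cast : ℤ → 𝕜) hint
    push_cast at hcast
    rw [hcast]
    have h1 := congrArg (Nat.cast : ℕ → 𝕜) (sum_card_mul_card (fun m => m = k) d hd)
    have h2 := congrArg (Nat.cast : ℕ → 𝕜) (sum_card_mul_card (fun m => m + 1 = k) d hd)
    push_cast at h1 h2
    simp only [sub_mul, Finset.sum_sub_distrib]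
    rw [h1, h2, ← sub_mul, mul_comm, mul_assoc,
      mul_inv_cancel₀ (Nat.cast_ne_zero.2 (Nat.factorial_ne_zero n)), mul_one]
  · have := isEmpty_semistandard hk hd
    rw [Nat.card_of_isEmpty, Nat.cast_zero, Finset.sum_eq_zero, mul_zero]
    intro σ _
    have : IsEmpty {f : Fin n → ℕ // f ∘ σ = f ∧ colorContent f = d} :=
      ⟨fun f => hd (by rw [← f.2.2, degree_colorContent])⟩
    rw [Nat.card_of_isEmpty (α := {f : Fin n → ℕ // f ∘ σ = f ∧ colorContent f = d}),
      Nat.cast_zero, mul_zero]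

theorem frob_gradedPiece_eq_zero (hk : n / 2 < k) :
    frob (gradedPiece 𝕜 n k).toRepresentation = 0 := by
  have h : Subsingleton (gradedPiece 𝕜 n k).toSubmodule := by
    rw [gradedPiece_eq_bot 𝕜 hk]
    infer_instance
  rw [frob, Finset.sum_eq_zero, smul_zero]
  intro σ _
  rw [Representation.character, Subsingleton.elim ((gradedPiece 𝕜 n k).toRepresentation σ) 0,
    map_zero, zero_smul]

theorem frobQ_eq : frobQ 𝕜 n = ∑ k : Fin (n / 2 + 1),
    PowerSeries.C (schur 𝕜 (twoRow n k (Nat.le_of_lt_succ k.2))) * PowerSeries.X ^ (k : ℕ) := by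
  ext1 m
  rw [frobQ, PowerSeries.coeff_mk, map_sum]
  simp only [PowerSeries.coeff_C_mul, PowerSeries.coeff_X_pow]
  by_cases hm : m ≤ n / 2
  · rw [Finset.sum_eq_single (⟨m, Nat.lt_succ_of_le hm⟩ : Fin (n / 2 + 1))]
    · rw [if_pos rfl, mul_one, frob_gradedPiece 𝕜 hm]
    · intro j _ hj
      rw [if_neg fun h => hj (Fin.ext h.symm), mul_zero]
    · simp
  · rw [frob_gradedPiece_eq_zero 𝕜 (by omega), Finset.sum_eq_zero]
    intro j _
    rw [if_neg (by have := j.2; omega), mul_zero]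

end Frobenius

end SpechtQuotient

end

theorem mainTheorem4 (𝕜 : Type*) [Field 𝕜] [CharZero 𝕜] (n : ℕ) :
    (∀ (k : ℕ) (hk : k ≤ n / 2),
      (∃ b : Module.Basis (SpechtQuotient.SYT (SpechtQuotient.twoRow n k hk) n) 𝕜
          (SpechtQuotient.gradedPiece 𝕜 n k).toSubmodule,
        ∀ T, (b T : SpechtQuotient.N 𝕜 n) =
          Ideal.Quotient.mk (SpechtQuotient.I 𝕜 n) (SpechtQuotient.G 𝕜 hk T.1)) ∧
      (SpechtQuotient.gradedPiece 𝕜 n k).toRepresentation.IsIrreducible ∧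
      Nonempty ((SpechtQuotient.gradedPiece 𝕜 n k).toRepresentation.Equiv
        (SpechtQuotient.spechtModule 𝕜 (SpechtQuotient.twoRow n k hk) n).toRepresentation)) ∧
    SpechtQuotient.frobQ 𝕜 n =
      ∑ k : Fin (n / 2 + 1),
        PowerSeries.C (SpechtQuotient.schur 𝕜
          (SpechtQuotient.twoRow n k (Nat.le_of_lt_succ k.2))) * PowerSeries.X ^ (k : ℕ) :=
  ⟨fun _ hk => ⟨⟨SpechtQuotient.basisG hk 𝕜, SpechtQuotient.coe_basisG hk 𝕜⟩,
    SpechtQuotient.isIrreducible_gradedPiece 𝕜 hk, ⟨SpechtQuotient.spechtRepEquiv 𝕜 hk⟩⟩,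
    SpechtQuotient.frobQ_eq 𝕜⟩
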